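/- All matroids and graphs are finite; graphs may have loops and parallel edges, and $M(G)$ denotes the cycle matroid of $G$. A matroid is graphic if it is isomorphic to $M(G)$ for some graph $G$. Let $M$ be a binary matroid on $E$ and $x,y\in E$ distinct. Take a matrix $A$ over $GF(2)$ that represents $M$, adjoin to it a row that is $1$ in the columns of $x$ and $y$ and $0$ elsewhere, and then a column, labelled by a new element $a\notin E$, that is $1$ in the new row and $0$ elsewhere. The vector matroid of the resulting matrix, on $E\cup\{a\}$, is the element splitting matroid $M'_{x,y}$. Let $M$ be a graphic matroid and $F$ a matroid. We say that $M$ is minimal with respect to $F$ under element splitting if no two elements of $M$ are in series (that is, $M$ has no cocircuit of size $2$) and there are two distinct elements $x,y$ of $M$, neither of which is a loop or a coloop of $M$, and which are not parallel in $M$, such that at least one of the five matroids $$M'_{x,y}\setminus\{a\}/\{x\},\quad M'_{x,y}\setminus\{a\}/\{x,y\},\quad M'_{x,y},\quad M'_{x,y}/\{x\},\quad M'_{x,y}/\{x,y\}$$ is isomorphic to $F$. **Lemma.** Let $M$ be a graphic matroid. Then $M$ is minimal with respect to $M(K_5)$ under element splitting if and only if $M$ is isomorphic to one of $M(G_{11}),M(G_{12}),\dots,M(G_{17})$,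 where, writing $ij$ for an edge joining the vertices $i$ and $j$, * $G_{11}$ (vertices $0,\dots,4$) is $K_5$ without the edge $12$ and with the edges $01$ and $02$ doubled ($11$ edges); * $G_{12}$ (vertices $0,\dots,5$) is $K_6$ without the edges $02,12,23,35$ and with the edge $24$ doubled ($12$ edges); * $G_{13}$ (vertices $0,\dots,5$) is $K_6$ without the edges $02,12,23,35$ and with the edge $25$ doubled ($12$ edges); * $G_{14}$ (vertices $0,\dots,5$) consists of a $K_4$ on $0,1,2,3$, the edges $42,43,50,51$, and two parallel edges $45$ ($12$ edges); * $G_{15}$ (vertices $0,\dots,5$) consists of a $K_4$ on $0,1,2,3$ with the edge $01$ doubled, and the edges $42,43,50,51,45$ ($12$ edges); * $G_{16}$ (vertices $0,\dots,4$) is $K_5$ without the edge $12$ and with the edge $01$ doubled ($10$ edges); * $G_{17}$ (vertices $0,\dots,5$) is $K_{3,3}$ with parts $\{0,1,2\}$ and $\{3,4,5\}$ together with the two edges $01$ and $34$ ($11$ edges). -/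

import Mathlib

open scoped Graph Matroid

namespace ElementSplitting

/-! ### Vector matroids -/

/-- The vector matroid of the matrix `A` on the set `E` of column labels: a set `I ⊆ E` is
independent when the columns labelled by `I` are linearly independent (as a family, so that
equal columns with different labels are dependent). -/
def vectorMatroid {m α K : Type*} [Field K] (A : Matrix m α K) (E : Set α) : Matroid α :=
  (IndepMatroid.ofFinitary E (fun I => I ⊆ E ∧ LinearIndepOn K A.col I)
    ⟨Set.empty_subset E, linearIndepOn_empty K A.col⟩
    (fun _ _ hJ hIJ => ⟨hIJ.trans hJ.1, hJ.2.mono hIJ⟩)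
    (by
      intro I B hI hImax hB
      obtain ⟨e, heI, he⟩ := Set.exists_insert_of_not_maximal
        (fun _ _ hJ hIJ => ⟨hIJ.trans hJ.1, hJ.2.mono hIJ⟩) hI hImax
      by_contra! hcon
      have hBI : ∀ x ∈ B, A.col x ∈ Submodule.span K (A.col '' I) := by
        intro x hx
        by_cases hxI : x ∈ I
        · exact Submodule.subset_span ⟨x, hxI, rfl⟩
        by_contra hspan
        exact hcon x ⟨hx, hxI⟩ (Set.insert_subset (hB.prop.1 hx) hI.1) (hI.2.insert hspan)
      have heB : A.col e ∈ Submodule.span K (A.col '' B) := by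
        by_cases heB : e ∈ B
        · exact Submodule.subset_span ⟨e, heB, rfl⟩
        by_contra hspan
        exact heB (hB.le_of_ge
          (⟨Set.insert_subset (he.1 (Set.mem_insert e I)) hB.prop.1, hB.prop.2.insert hspan⟩ :
            insert e B ⊆ E ∧ LinearIndepOn K A.col (insert e B))
          (Set.subset_insert e B) (Set.mem_insert e B))
      have hle : Submodule.span K (A.col '' B) ≤ Submodule.span K (A.col '' I) := by
        rw [Submodule.span_le]
        rintro _ ⟨x, hx, rfl⟩
        exact hBI x hx
      exact ((linearIndepOn_insert heI).1 he.2).2 (hle heB))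
    (fun I h =>
      ⟨fun x hx => (h {x} (by simpa using hx) (Set.finite_singleton x)).1 rfl,
        linearIndepOn_of_finite I fun t ht hfin => (h t ht hfin).2⟩)
    (fun _ hI => hI.1)).matroid

theorem vectorMatroid_indep {m α K : Type*} [Field K] (A : Matrix m α K) (E I : Set α) :
    (vectorMatroid A E).Indep I ↔ I ⊆ E ∧ LinearIndepOn K A.col I := Iff.rfl

/-! ### Cycle matroids -/

/-- Two vertices are joined by a walk of `G` all of whose edges lie in `I`. -/
def Joined {V β : Type*} (G : Graph V β) (I : Set β) : V → V → Prop :=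
  Relation.ReflTransGen (fun u v => ∃ e ∈ I, G.IsLink e u v)

/-- `I` is the edge set of a forest of `G`, that is, `I` contains the edge set of no cycle
(loops and pairs of parallel edges are cycles): no edge `e` of `I` has its two ends
joined by a walk through edges of `I` other than `e`. -/
def IsForest {V β : Type*} (G : Graph V β) (I : Set β) : Prop :=
  I ⊆ E(G) ∧ ∀ e ∈ I, ∀ u v, G.IsLink e u v → ¬ Joined G (I \ {e}) u v

section

variable {V β : Type*} {G : Graph V β} {I J : Set β} {u v w : V} {e f : β}

theorem Joined.mono (hIJ : I ⊆ J) (h : Joined G I u v) : Joined G J u v := by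
  induction h with
  | refl => exact .refl
  | tail _ hbc ih =>
    obtain ⟨e, he, hl⟩ := hbc
    exact .tail ih ⟨e, hIJ he, hl⟩

theorem Joined.symm (h : Joined G I u v) : Joined G I v u := by
  induction h with
  | refl => exact .refl
  | tail _ hbc ih =>
    obtain ⟨e, he, hl⟩ := hbc
    exact .head ⟨e, he, hl.symm⟩ ih

theorem Joined.trans (h : Joined G I u v) (h' : Joined G I v w) : Joined G I u w :=
  Relation.ReflTransGen.trans h h'

theorem Joined.of_link (he : e ∈ I) (h : G.IsLink e u v) : Joined G I u v :=
  .single ⟨e, he, h⟩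

theorem Joined.of_forall (h : Joined G J u v)
    (hJ : ∀ e ∈ J, ∀ x y, G.IsLink e x y → Joined G I x y) : Joined G I u v := by
  induction h with
  | refl => exact .refl
  | tail _ hbc ih =>
    obtain ⟨e, he, hl⟩ := hbc
    exact ih.trans (hJ e he _ _ hl)

theorem Joined.exists_finite (h : Joined G I u v) :
    ∃ J ⊆ I, J.Finite ∧ Joined G J u v := by
  induction h with
  | refl => exact ⟨∅, Set.empty_subset I, Set.finite_empty, .refl⟩
  | tail _ hbc ih =>
    obtain ⟨e, he, hl⟩ := hbc
    obtain ⟨J, hJI, hJ, hj⟩ := ih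
    exact ⟨insert e J, Set.insert_subset he hJI, hJ.insert e,
      (hj.mono (Set.subset_insert e J)).trans (.of_link (Set.mem_insert e J) hl)⟩

/-- A walk through `I` and the edge `f = ab` either avoids `f`, or joins its ends to the ends of
`f` in one of the two orders. -/
theorem Joined.insert_cases {a b : V} (hf : G.IsLink f a b) (h : Joined G (insert f I) u v) :
    Joined G I u v ∨ (Joined G I u a ∧ Joined G I b v) ∨ (Joined G I u b ∧ Joined G I a v) := by
  induction h with
  | refl => exact .inl .refl
  | tail _ hbc ih =>
    obtain ⟨e, rfl | he, hl⟩ := hbc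
    · obtain ⟨rfl, rfl⟩ | ⟨rfl, rfl⟩ := hf.eq_and_eq_or_eq_and_eq hl
      · obtain h | ⟨h, -⟩ | ⟨h, -⟩ := ih
        · exact .inr (.inl ⟨h, .refl⟩)
        · exact .inr (.inl ⟨h, .refl⟩)
        · exact .inl h
      · obtain h | ⟨h, -⟩ | ⟨h, -⟩ := ih
        · exact .inr (.inr ⟨h, .refl⟩)
        · exact .inl h
        · exact .inr (.inr ⟨h, .refl⟩)
    · have h1 := Joined.of_link he hl
      obtain h | ⟨h, h'⟩ | ⟨h, h'⟩ := ih
      · exact .inl (h.trans h1)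
      · exact .inr (.inl ⟨h, h'.trans h1⟩)
      · exact .inr (.inr ⟨h, h'.trans h1⟩)

theorem IsForest.subset (hJ : IsForest G J) (hIJ : I ⊆ J) : IsForest G I :=
  ⟨hIJ.trans hJ.1, fun e he u v hl h =>
    hJ.2 e (hIJ he) u v hl (h.mono (Set.sdiff_subset_sdiff_left hIJ))⟩

theorem IsForest.insert {a b : V} (hI : IsForest G I) (hf : G.IsLink f a b)
    (hab : ¬ Joined G I a b) : IsForest G (insert f I) := by
  refine ⟨Set.insert_subset hf.edge_mem hI.1, fun e he u v hl h => ?_⟩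
  by_cases hef : e = f
  · subst hef
    have h' : Joined G I u v := h.mono (by
      rintro x ⟨rfl | hx, hxe⟩
      · exact absurd rfl hxe
      · exact hx)
    obtain ⟨rfl, rfl⟩ | ⟨rfl, rfl⟩ := hf.eq_and_eq_or_eq_and_eq hl
    · exact hab h'
    · exact hab h'.symm
  · have heI : e ∈ I := he.resolve_left hef
    have h' : Joined G (Insert.insert f (I \ {e})) u v := h.mono (by
      rintro x ⟨rfl | hx, hxe⟩
      · exact .inl rfl
      · exact .inr ⟨hx, hxe⟩)
    have huv : Joined G I u v := .of_link heI hl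
    have hm : I \ {e} ⊆ I := Set.sdiff_subset
    obtain h0 | ⟨h1, h2⟩ | ⟨h1, h2⟩ := h'.insert_cases hf
    · exact hI.2 e heI u v hl h0
    · exact hab (((h1.mono hm).symm.trans huv).trans (h2.mono hm).symm)
    · exact hab (((h2.mono hm).trans huv.symm).trans (h1.mono hm))

end

/-- The cycle matroid `M(G)`: its ground set is the edge set of `G`, its independent sets are the
edge sets of the forests of `G`. -/
def cycleMatroid {V β : Type*} (G : Graph V β) : Matroid β :=
  (IndepMatroid.ofFinitary E(G) (IsForest G)
    ⟨Set.empty_subset _, fun e he => absurd he (Set.notMem_empty e)⟩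
    (fun _ _ hJ hIJ => hJ.subset hIJ)
    (by
      intro I B hI hImax hB
      obtain ⟨e, heI, he⟩ := Set.exists_insert_of_not_maximal
        (fun _ _ hJ hIJ => IsForest.subset hJ hIJ) hI hImax
      obtain ⟨a, b, hab⟩ := G.exists_isLink_of_mem_edgeSet (he.1 (Set.mem_insert e I))
      by_contra! hcon
      have hBI : ∀ x ∈ B, ∀ u v, G.IsLink x u v → Joined G I u v := by
        intro x hx u v hl
        by_cases hxI : x ∈ I
        · exact .of_link hxI hl
        by_contra hj
        exact hcon x ⟨hx, hxI⟩ (hI.insert hl hj)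
      have hj : Joined G B a b := by
        by_contra hj
        have heB := hB.le_of_ge (hB.prop.insert hab hj) (Set.subset_insert e B)
          (Set.mem_insert e B)
        exact hj (.of_link heB hab)
      refine he.2 e (Set.mem_insert e I) a b hab ((hj.of_forall hBI).mono ?_)
      intro x hx
      exact ⟨.inr hx, fun h => heI (h ▸ hx)⟩)
    (by
      intro I h
      refine ⟨fun x hx => (h {x} (by simpa using hx) (Set.finite_singleton x)).1 rfl,
        fun e he u v hl hj => ?_⟩
      obtain ⟨J, hJ, hfin, hj'⟩ := hj.exists_finite
      refine (h (insert e J) (Set.insert_subset he (hJ.trans Set.sdiff_subset))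
        (hfin.insert e)).2 e (Set.mem_insert e J) u v hl (hj'.mono ?_)
      intro x hx
      exact ⟨.inr hx, (hJ hx).2⟩)
    (fun _ hI => hI.1)).matroid

theorem cycleMatroid_indep {V β : Type*} (G : Graph V β) (I : Set β) :
    (cycleMatroid G).Indep I ↔ IsForest G I := Iff.rfl

/-! ### Isomorphism, graphic matroids, element splitting -/

/-- Isomorphism of matroids: a bijection between the ground sets that preserves independence in
both directions. -/
def Isomorphic {α β : Type*} (M : Matroid α) (N : Matroid β) : Prop :=
  ∃ φ : M.E ≃ N.E, ∀ I : Set M.E,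
    M.Indep (Subtype.val '' I) ↔ N.Indep (Subtype.val '' (φ '' I))

/-- A (finite) matroid is graphic when it is isomorphic to the cycle matroid of a finite graph;
loops and parallel edges are allowed. -/
def IsGraphic {α : Type*} (M : Matroid α) : Prop :=
  ∃ (V β : Type) (G : Graph V β), V(G).Finite ∧ E(G).Finite ∧ Isomorphic M (cycleMatroid G)

/-- The matrix `A'_X`: adjoin to `A` a row that is `1` exactly in the columns of `X`, and then a
column (labelled `Sum.inr ()`, the new element `a`) that is `1` in the new row and `0` in
all others. -/
noncomputable def splittingMatrix {m α : Type*} (A : Matrix m α (ZMod 2)) (X : Set α) :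
    Matrix (m ⊕ Unit) (α ⊕ Unit) (ZMod 2) :=
  Matrix.fromBlocks A 0 (Matrix.replicateRow Unit (X.indicator 1)) 1

/-- `M'` is the element splitting matroid `M'_X` of the binary matroid `M`: for a matrix `A` over
`GF(2)` that represents `M`, it is the vector matroid of `A'_X`, on the ground set
`M.E ∪ {a}`. -/
def IsElementSplitting {α : Type*} (M : Matroid α) (X : Set α) (M' : Matroid (α ⊕ Unit)) : Prop :=
  ∃ (n : ℕ) (A : Matrix (Fin n) α (ZMod 2)), M = vectorMatroid A M.E ∧
    M' = vectorMatroid (splittingMatrix A X) (Sum.inl '' M.E ∪ {Sum.inr ()})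

/-- `M` is minimal with respect to `F` and the element splitting operation: no two elements of
`M` are in series (`M` has no cocircuit with two elements), and there are two distinct
elements `x`, `y`, which are neither loops nor coloops and are not parallel, such that one of
`M'_{x,y} \ a / x`, `M'_{x,y} \ a / {x,y}`, `M'_{x,y}`, `M'_{x,y} / x`, `M'_{x,y} / {x,y}` is
isomorphic to `F`. -/
def IsMinimal {α β : Type*} (M : Matroid α) (F : Matroid β) : Prop :=
  (∀ x y, x ≠ y → ¬ M.IsCocircuit {x, y}) ∧
  ∃ x ∈ M.E, ∃ y ∈ M.E, x ≠ y ∧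
    ¬ M.IsLoop x ∧ ¬ M.IsLoop y ∧ ¬ M.IsColoop x ∧ ¬ M.IsColoop y ∧ ¬ M.IsCircuit {x, y} ∧
    ∃ M' : Matroid (α ⊕ Unit), IsElementSplitting M {x, y} M' ∧
      (Isomorphic (M' ＼ {Sum.inr ()} ／ {Sum.inl x}) F ∨
        Isomorphic (M' ＼ {Sum.inr ()} ／ {Sum.inl x, Sum.inl y}) F ∨
        Isomorphic M' F ∨
        Isomorphic (M' ／ {Sum.inl x}) F ∨
        Isomorphic (M' ／ {Sum.inl x, Sum.inl y}) F)

/-! ### The graphs -/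

/-- The graph with vertex set `V` and edge set `β` in which the edge `e` has the pair of ends
`ends e`. -/
def graphOfEnds {V β : Type*} (ends : β → Sym2 V) : Graph V β where
  vertexSet := Set.univ
  edgeSet := Set.univ
  IsLink e u v := ends e = s(u, v)
  isLink_symm e _ := ⟨fun u v h => h.trans Sym2.eq_swap⟩
  eq_or_eq_of_isLink_of_isLink e x y v w h h' := by
    obtain ⟨h, -⟩ | ⟨h, -⟩ := Sym2.eq_iff.1 (h.symm.trans h')
    · exact .inl h
    · exact .inr h
  edge_mem_iff_exists_isLink e := by
    refine ⟨fun _ => ?_, fun _ => Set.mem_univ e⟩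
    induction h : ends e with
    | h u v => exact ⟨u, v, rfl⟩
  left_mem_of_isLink _ u _ _ := Set.mem_univ u

/-- The complete graph on five vertices. -/
def K5 : Graph (Fin 5) (⊤ : SimpleGraph (Fin 5)).edgeSet :=
  graphOfEnds Subtype.val

/-- `K₅` without the edge `12`, with the edges `01` and `02` doubled. -/
def G11 : Graph (Fin 5) (Fin 11) :=
  graphOfEnds ![s(0, 1), s(0, 1), s(0, 2), s(0, 2), s(0, 3), s(0, 4), s(1, 3), s(1, 4), s(2, 3),
    s(2, 4), s(3, 4)]

/-- `K₆` without the edges `02`, `12`, `23`, `35`, with the edge `24` doubled. -/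
def G12 : Graph (Fin 6) (Fin 12) :=
  graphOfEnds ![s(0, 1), s(0, 3), s(0, 4), s(0, 5), s(1, 3), s(1, 4), s(1, 5), s(2, 4), s(2, 4),
    s(2, 5), s(3, 4), s(4, 5)]

/-- `K₆` without the edges `02`, `12`, `23`, `35`, with the edge `25` doubled. -/
def G13 : Graph (Fin 6) (Fin 12) :=
  graphOfEnds ![s(0, 1), s(0, 3), s(0, 4), s(0, 5), s(1, 3), s(1, 4), s(1, 5), s(2, 4), s(2, 5),
    s(2, 5), s(3, 4), s(4, 5)]

/-- `K₄` on `0`, `1`, `2`, `3`, two further vertices `4` and `5` joined by two parallel edges,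
`4` adjacent to `2` and `3`, and `5` adjacent to `0` and `1`. -/
def G14 : Graph (Fin 6) (Fin 12) :=
  graphOfEnds ![s(0, 1), s(0, 2), s(0, 3), s(1, 2), s(1, 3), s(2, 3), s(2, 4), s(3, 4), s(0, 5),
    s(1, 5), s(4, 5), s(4, 5)]

/-- `K₄` on `0`, `1`, `2`, `3` with the edge `01` doubled, two further adjacent vertices `4` and
`5`, `4` adjacent to `2` and `3`, and `5` adjacent to `0` and `1`. -/
def G15 : Graph (Fin 6) (Fin 12) :=
  graphOfEnds ![s(0, 1), s(0, 1), s(0, 2), s(0, 3), s(1, 2), s(1, 3), s(2, 3), s(2, 4), s(3, 4),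
    s(0, 5), s(1, 5), s(4, 5)]

/-- `K₅` without the edge `12`, with the edge `01` doubled. -/
def G16 : Graph (Fin 5) (Fin 10) :=
  graphOfEnds ![s(0, 1), s(0, 1), s(0, 2), s(0, 3), s(0, 4), s(1, 3), s(1, 4), s(2, 3),
    s(2, 4), s(3, 4)]

/-- `K₃,₃` with parts `{0, 1, 2}` and `{3, 4, 5}`, with the two further edges `01` and `34`. -/
def G17 : Graph (Fin 6) (Fin 11) :=
  graphOfEnds ![s(0, 3), s(0, 4), s(0, 5), s(1, 3), s(1, 4), s(1, 5), s(2, 3), s(2, 4), s(2, 5),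
    s(0, 1), s(3, 4)]

end ElementSplitting

/-! Over GF(2) the coefficients in a linear relation are 0 or 1, so a representation `v` of `M`
matters only through the finite sets of columns with sum zero. Any convenient representation may
therefore replace the given one, and the element splitting can be computed from it: `x` and `y`
become `(v x, 1)` and `(v y, 1)`, the new element `a` is `(0, 1)`, and every other `e` becomes `(v
e, 0)`.

Contracting `x` applies `(w, t) ↦ w + t • v x`: `y` moves to `v x + v y`, `a` takes the place of
`x`, and nothing else changes. Contracting `y` as well passes to the quotient by `v x + v y`. So
four of the five minors are `M` with `y` moved, without or with `x` (`delete_contract_iff`,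
`contract_iff`), and the image of `M` without `y` in the quotient, without or with `x`
(`delete_contract_pair_iff`, `contract_pair_iff`). The fifth, `M'` itself, is never `M(K₅)`: the new
coordinate is 1 exactly on `x`, `y`, `a`, whereas a cut of `K₅` has 0, 4 or 6 edges.

Suppose that one of the four is `M(K₅)`. Since `x` is not a coloop and there are no series pairs,
some circuit contains `x` and avoids `y`, so `v x` lies in the span of the other elements. Hence `M`
has rank at most 4 when `y` is moved and at most 5 in the quotient case. A graphic matroid of rank
at most `n` comes from a graph on `n + 1` vertices, by identification of vertices
(`exists_sameSums_fin`), and the vertices can be relabeled so that `x` is the edge 01 and `y` is 12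
or 23. Finitely many graphs remain. `M(K₅)` is recognized by ten distinct nonzero vectors with six
prescribed triangles (`IsK5Config`), so the four edges at one vertex determine the rest, up to the
vector that is factored out; the search runs over these. In the quotient case the absence of series
pairs is used once more: the star of each end of `x` and of `y` has at least three edges
(`three_le_card`). The survivors are relabelings of `G11` and `G16` (moved), `G12` (quotient, `x`
and `y` adjacent), and `G13`, `G14`, `G15`, `G17` (quotient, disjoint).

Conversely, each of the seven graphs has an explicit pair `x`, `y`, an explicit copy of `K₅`, and a
list of cycles separating its edges, which excludes coloops and series pairs. -/

namespace ElementSplitting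

/-! ### Linear independence over the two-element field -/

section SameSums

variable {ι κ W W' : Type*} [AddCommGroup W] [AddCommGroup W']

/-- Two families of vectors over the two-element field in which the same finite subfamilies have
sum zero. -/
def SameSums (v : ι → W) (w : ι → W') : Prop :=
  ∀ C : Finset ι, ∑ i ∈ C, v i = 0 ↔ ∑ i ∈ C, w i = 0

theorem SameSums.symm {v : ι → W} {w : ι → W'} (h : SameSums v w) : SameSums w v :=
  fun C => (h C).symm

theorem SameSums.trans {W'' : Type*} [AddCommGroup W'']
    {v : ι → W} {w : ι → W'} {u : ι → W''} (h : SameSums v w) (h' : SameSums w u) :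
    SameSums v u :=
  fun C => (h C).trans (h' C)

theorem SameSums.comp {v : ι → W} {w : ι → W'} (h : SameSums v w) {f : κ → ι}
    (hf : Function.Injective f) : SameSums (v ∘ f) (w ∘ f) := by
  intro C
  simpa using h (C.map ⟨f, hf⟩)

end SameSums

section Binary

variable {ι κ α β W W' : Type*} [AddCommGroup W] [Module (ZMod 2) W]
  [AddCommGroup W'] [Module (ZMod 2) W']

/-- A linear combination over GF(2) is the sum over the set of indices with nonzero coefficient. -/
theorem linearIndepOn_iff_sum_ne_zero {v : ι → W} {I : Set ι} :
    LinearIndepOn (ZMod 2) v I ↔ ∀ C : Finset ι, ↑C ⊆ I → ∑ i ∈ C, v i = 0 → C = ∅ := by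
  classical
  rw [linearIndepOn_iff']
  constructor
  · intro h C hC h0
    refine Finset.eq_empty_of_forall_notMem fun i hi => ?_
    exact one_ne_zero (h C (fun _ => 1) hC (by simpa using h0) i hi)
  · intro h t g ht h0 i hi
    by_contra hgi
    have h1 : ∑ j ∈ t with g j ≠ 0, v j = 0 := by
      rw [← h0, Finset.sum_filter]
      refine Finset.sum_congr rfl fun j _ => ?_
      have : ∀ a : ZMod 2, a = 0 ∨ a = 1 := by decide
      rcases this (g j) with hj | hj <;> simp [hj]
    have h2 := h _ ((Finset.coe_subset.2 (Finset.filter_subset _ _)).trans ht) h1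
    have : i ∈ ({j ∈ t | g j ≠ 0} : Finset ι) := by simp [hi, hgi]
    simp [h2] at this

theorem SameSums.of_injective (v : ι → W) (f : W →ₗ[ZMod 2] W')
    (hf : ∀ x ∈ Submodule.span (ZMod 2) (Set.range v), f x = 0 → x = 0) :
    SameSums v (f ∘ v) := by
  intro C
  simp only [Function.comp, ← map_sum]
  refine ⟨fun h => by rw [h, map_zero], fun h => hf _ ?_ h⟩
  exact Submodule.sum_mem _ fun i _ => Submodule.subset_span ⟨i, rfl⟩

/-- Uniqueness of binary representations. A zero-sum set either splits into two smaller ones,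
treated by induction, or is a minimal dependent set for `v`. In the latter case it is dependent for
`w`, and a proper zero-sum subset for `w` would be dependent for `v`, against minimality. -/
theorem sum_eq_zero_of_forall_linearIndepOn_iff {v : ι → W} {w : ι → W'} {S : Set ι}
    (h : ∀ I ⊆ S, LinearIndepOn (ZMod 2) v I ↔ LinearIndepOn (ZMod 2) w I) (C : Finset ι)
    (hCS : ↑C ⊆ S) (hC : ∑ i ∈ C, v i = 0) : ∑ i ∈ C, w i = 0 := by
  classical
  induction C using Finset.strongInduction with
  | H C ih =>
  rcases C.eq_empty_or_nonempty with rfl | hne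
  · simp
  by_cases hmin : ∃ D, D ⊂ C ∧ D.Nonempty ∧ ∑ i ∈ D, v i = 0
  · obtain ⟨D, hDC, hDne, hD⟩ := hmin
    have h1 := Finset.sum_sdiff (f := v) hDC.subset
    have h2 := Finset.sum_sdiff (f := w) hDC.subset
    rw [hD, add_zero, hC] at h1
    rw [← h2, ih D hDC ((Finset.coe_subset.2 hDC.subset).trans hCS) hD,
      ih (C \ D) (Finset.sdiff_ssubset hDC.subset hDne)
        ((Finset.coe_subset.2 Finset.sdiff_subset).trans hCS) h1, add_zero]
  · have hw : ¬ LinearIndepOn (ZMod 2) w (C : Set ι) := by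
      rw [← h _ hCS, linearIndepOn_iff_sum_ne_zero]
      exact fun hn => hne.ne_empty (hn C subset_rfl hC)
    rw [linearIndepOn_iff_sum_ne_zero] at hw
    push Not at hw
    obtain ⟨D, hDC, hD, hDne⟩ := hw
    rw [Finset.coe_subset] at hDC
    obtain rfl | hss := hDC.eq_or_ssubset
    · exact hD
    exfalso
    have hv : ¬ LinearIndepOn (ZMod 2) v (D : Set ι) := by
      rw [h _ ((Finset.coe_subset.2 hDC).trans hCS), linearIndepOn_iff_sum_ne_zero]
      exact fun hn => hDne.ne_empty (hn D subset_rfl hD)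
    rw [linearIndepOn_iff_sum_ne_zero] at hv
    push Not at hv
    obtain ⟨D', hDD', hD', hDne'⟩ := hv
    exact hmin ⟨D', (Finset.coe_subset.1 hDD').trans_ssubset hss, hDne', hD'⟩

theorem sameSums_iff {v : ι → W} {w : ι → W'} :
    SameSums v w ↔ ∀ I, LinearIndepOn (ZMod 2) v I ↔ LinearIndepOn (ZMod 2) w I := by
  refine ⟨fun h I => ?_, fun h C => ⟨?_, ?_⟩⟩
  · simp only [linearIndepOn_iff_sum_ne_zero, h _]
  · exact sum_eq_zero_of_forall_linearIndepOn_iff (S := Set.univ) (fun I _ => h I) C (by simp)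
  · exact sum_eq_zero_of_forall_linearIndepOn_iff (S := Set.univ) (fun I _ => (h I).symm) C
      (by simp)

/-- The vectors `v e` represent the matroid `M` over the two-element field. -/
def IsRep (M : Matroid α) (v : α → W) : Prop :=
  ∀ I, M.Indep I ↔ I ⊆ M.E ∧ LinearIndepOn (ZMod 2) v I

variable {M : Matroid α} {N : Matroid β} {v : α → W} {w : β → W'}

theorem linearIndepOn_image_iff {f : ι → κ} (hf : Function.Injective f) (u : κ → W) (I : Set ι) :
    LinearIndepOn (ZMod 2) u (f '' I) ↔ LinearIndepOn (ZMod 2) (u ∘ f) I :=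
  ⟨fun h => h.comp_of_image hf.injOn, LinearIndepOn.image_of_comp f u⟩

theorem IsRep.indep_iff (h : IsRep M v) {I : Set α} (hI : I ⊆ M.E) :
    M.Indep I ↔ LinearIndepOn (ZMod 2) v I := by
  rw [h I, and_iff_right hI]

theorem isRep_iff_subtype : IsRep M v ↔
    ∀ I : Set M.E, M.Indep (Subtype.val '' I) ↔ LinearIndepOn (ZMod 2) (v ∘ Subtype.val) I := by
  constructor
  · intro h I
    rw [h, and_iff_right (by simp), linearIndepOn_image_iff Subtype.val_injective]
  · intro h I
    by_cases hI : I ⊆ M.E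
    · have := h (Subtype.val ⁻¹' I)
      rw [← linearIndepOn_image_iff Subtype.val_injective,
        Subtype.image_preimage_coe, Set.inter_eq_right.2 hI] at this
      rw [this, and_iff_right hI]
    · exact iff_of_false (fun h => hI h.subset_ground) fun h => hI h.1

theorem IsRep.congr (h : IsRep M v) {u : α → W'}
    (hu : SameSums (fun e : M.E => v e) (fun e : M.E => u e)) : IsRep M u := by
  rw [isRep_iff_subtype] at h ⊢
  intro I
  exact (h I).trans (sameSums_iff.1 hu I)

theorem IsRep.sameSums (h : IsRep M v) {u : α → W'} (hu : IsRep M u) :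
    SameSums (fun e : M.E => v e) (fun e : M.E => u e) := by
  rw [isRep_iff_subtype] at h hu
  exact sameSums_iff.2 fun I => (h I).symm.trans (hu I)

theorem IsRep.isomorphic_iff (hM : IsRep M v) (hN : IsRep N w) :
    Isomorphic M N ↔ ∃ φ : M.E ≃ N.E, SameSums (fun e : M.E => v e) (fun e => w (φ e)) := by
  rw [isRep_iff_subtype] at hM hN
  refine exists_congr fun φ => ?_
  rw [sameSums_iff]
  refine forall_congr' fun I => ?_
  rw [hM, hN, linearIndepOn_image_iff φ.injective]
  rfl

theorem IsRep.sum_eq_zero_of_isCircuit (h : IsRep M v) {C : Set α} (hC : M.IsCircuit C) :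
    ∃ D : Finset α, ↑D = C ∧ ∑ e ∈ D, v e = 0 := by
  have h1 : ¬ LinearIndepOn (ZMod 2) v C := by
    rw [← h.indep_iff hC.subset_ground]
    exact hC.not_indep
  rw [linearIndepOn_iff_sum_ne_zero] at h1
  push Not at h1
  obtain ⟨D, hDC, hD, hne⟩ := h1
  refine ⟨D, ?_, hD⟩
  refine hC.eq_of_not_indep_subset (fun hi => ?_) hDC
  rw [h.indep_iff (hDC.trans hC.subset_ground), linearIndepOn_iff_sum_ne_zero] at hi
  exact hne.ne_empty (hi D subset_rfl hD)

/-- A zero-sum set is a disjoint union of circuits: while it is not minimal, pass to the part that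
contains `p`. -/
theorem IsRep.exists_isCircuit (h : IsRep M v) {C : Finset α} (hCE : ↑C ⊆ M.E)
    (hC : ∑ e ∈ C, v e = 0) {p : α} (hp : p ∈ C) : ∃ D ⊆ (C : Set α), M.IsCircuit D ∧ p ∈ D := by
  classical
  induction C using Finset.strongInduction with
  | H C ih =>
  by_cases hmin : ∃ D, D ⊂ C ∧ D.Nonempty ∧ ∑ i ∈ D, v i = 0
  · obtain ⟨D, hDC, hDne, hD⟩ := hmin
    by_cases hpD : p ∈ D
    · obtain ⟨X, hX, hX'⟩ := ih D hDC ((Finset.coe_subset.2 hDC.subset).trans hCE) hD hpD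
      exact ⟨X, hX.trans (Finset.coe_subset.2 hDC.subset), hX'⟩
    · have h1 := Finset.sum_sdiff (f := v) hDC.subset
      rw [hD, add_zero, hC] at h1
      obtain ⟨X, hX, hX'⟩ := ih (C \ D) (Finset.sdiff_ssubset hDC.subset hDne)
        ((Finset.coe_subset.2 Finset.sdiff_subset).trans hCE) h1 (by simp [hp, hpD])
      exact ⟨X, hX.trans (Finset.coe_subset.2 Finset.sdiff_subset), hX'⟩
  · refine ⟨C, subset_rfl, ?_, hp⟩
    rw [Matroid.isCircuit_iff_forall_ssubset]
    refine ⟨⟨fun hi => ?_, hCE⟩, fun I hI => ?_⟩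
    · rw [h.indep_iff hCE, linearIndepOn_iff_sum_ne_zero] at hi
      simp [hi C subset_rfl hC] at hp
    · rw [h.indep_iff (hI.subset.trans hCE), linearIndepOn_iff_sum_ne_zero]
      intro D hD hD0
      by_contra hne
      exact hmin ⟨D, Finset.coe_ssubset.1 (hD.trans_ssubset hI),
        Finset.nonempty_iff_ne_empty.2 hne, hD0⟩

theorem IsRep.isLoop_iff (h : IsRep M v) {x : α} (hx : x ∈ M.E) : M.IsLoop x ↔ v x = 0 := by
  rw [← Matroid.singleton_dep, ← Matroid.not_indep_iff (by simpa using hx),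
    h.indep_iff (by simpa using hx), linearIndepOn_singleton_iff, not_not]

theorem IsRep.isCircuit_pair_iff (h : IsRep M v) {x y : α} (hx : x ∈ M.E) (hy : y ∈ M.E)
    (hxy : x ≠ y) (hx0 : v x ≠ 0) (hy0 : v y ≠ 0) : M.IsCircuit {x, y} ↔ v x = v y := by
  classical
  have hneg : ∀ a b : W, a + b = 0 ↔ a = b := fun a b => by
    rw [add_eq_zero_iff_eq_neg, ZModModule.neg_eq_self]
  constructor
  · intro hC
    obtain ⟨D, hD, h0⟩ := h.sum_eq_zero_of_isCircuit hC
    have : D = {x, y} := by exact_mod_cast hD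
    rw [this, Finset.sum_pair hxy, hneg] at h0
    exact h0
  · intro he
    have hsub : (({x, y} : Finset α) : Set α) ⊆ M.E := by
      intro z hz
      simp only [Finset.coe_insert, Finset.coe_singleton, Set.mem_insert_iff,
        Set.mem_singleton_iff] at hz
      obtain rfl | rfl := hz <;> assumption
    obtain ⟨D, hD, hC, hxD⟩ := h.exists_isCircuit hsub
      (by rw [Finset.sum_pair hxy, hneg]; exact he) (p := x) (by simp)
    have : D = {x, y} := by
      refine subset_antisymm (by simpa using hD) ?_
      rintro z (rfl | rfl)
      · exact hxD
      by_contra hyD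
      have : D = {x} := by
        refine subset_antisymm (fun z hz => ?_) (by simpa using hxD)
        have := hD hz
        simp only [Finset.coe_insert, Finset.coe_singleton, Set.mem_insert_iff,
          Set.mem_singleton_iff] at this
        obtain rfl | rfl := this
        · rfl
        · exact absurd hz hyD
      rw [this] at hC
      exact hx0 ((h.isLoop_iff hx).1 (Matroid.singleton_isCircuit.1 hC))
    rwa [← this]

/-- If every circuit through `x` contained `q`, then `x` would be a coloop of `M ＼ {q}`, so `x`
would lie in the closure of `q` in the dual. As `x` is not a dual loop, `x` and `q` would be
parallel in the dual, that is, in series. -/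
theorem exists_isCircuit_of_not_isCocircuit_pair {x q : α} (hx : x ∈ M.E)
    (hxq : x ≠ q) (hxc : ¬ M.IsColoop x) (h : ¬ M.IsCocircuit {x, q}) :
    ∃ C, M.IsCircuit C ∧ x ∈ C ∧ q ∉ C := by
  by_contra! hcon
  apply h
  have hcol : (M ＼ {q}).IsColoop x := by
    rw [Matroid.isColoop_iff_forall_notMem_isCircuit (by simp [hx, hxq])]
    intro C hC hxC
    rw [Matroid.delete_isCircuit_iff] at hC
    exact Set.disjoint_singleton_right.1 hC.2 (hcon C hC.1 hxC)
  rw [Matroid.IsColoop, Matroid.dual_delete, Matroid.contract_isLoop_iff_mem_closure] at hcol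
  have hxl : x ∉ M✶.loops := fun hl => hxc hl
  have hqE : q ∈ M✶.E := by
    by_contra hqE
    have h1 := hcol.1
    rw [← Matroid.closure_inter_ground, Set.singleton_inter_eq_empty.2 hqE,
      Matroid.closure_empty] at h1
    exact hxl h1
  have hq : M✶.IsNonloop q := by
    rw [← Matroid.not_isLoop_iff hqE]
    intro hl
    apply hxl
    rw [← hl.closure]
    exact hcol.1
  refine hq.indep.insert_isCircuit_of_forall hcol.2 hcol.1 ?_
  rintro f rfl
  rwa [Set.sdiff_self, Matroid.closure_empty]

theorem not_isCocircuit_pair_of_isCircuit {x q : α} {C : Set α} (hC : M.IsCircuit C)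
    (hxC : x ∈ C) (hqC : q ∉ C) : ¬ M.IsCocircuit {x, q} := by
  intro hK
  obtain ⟨z, hz, hzx⟩ := (hC.isCocircuit_inter_nontrivial hK ⟨x, hxC, by simp⟩).exists_ne x
  obtain ⟨hzC, rfl | rfl⟩ := hz
  · exact hzx rfl
  · exact hqC hzC

/-- If no pair of elements is a cocircuit and `x` is not a coloop, then every linear functional that
does not vanish on `x` takes the value `1` on at least three elements. -/
theorem IsRep.three_le_card (h : IsRep M v) (hs : ∀ x y, x ≠ y → ¬ M.IsCocircuit {x, y})
    {x : α} (hx : x ∈ M.E) (hxc : ¬ M.IsColoop x) (f : W →ₗ[ZMod 2] ZMod 2) (hf : f (v x) ≠ 0) :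
    ∃ p ∈ M.E, ∃ q ∈ M.E, p ≠ x ∧ q ≠ x ∧ p ≠ q ∧ f (v p) ≠ 0 ∧ f (v q) ≠ 0 := by
  classical
  -- `f` sums to zero over a circuit, so it cannot be nonzero at `x` alone. A circuit through `x`
  -- gives `p`; another one, chosen to avoid `p`, gives `q`.
  have key : ∀ C, M.IsCircuit C → x ∈ C → ∃ q ∈ C, q ≠ x ∧ f (v q) ≠ 0 := by
    intro C hC hxC
    obtain ⟨D, rfl, hD⟩ := h.sum_eq_zero_of_isCircuit hC
    by_contra! hcon
    have h1 := congrArg f hD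
    rw [map_sum, map_zero, Finset.sum_eq_single_of_mem x (by simpa using hxC)
      fun b hb hbx => hcon b (by simpa using hb) hbx] at h1
    exact hf h1
  obtain ⟨C, hC, hxC⟩ := Matroid.exists_mem_isCircuit_of_not_isColoop hx hxc
  obtain ⟨p, hpC, hpx, hp⟩ := key C hC hxC
  obtain ⟨C', hC', hxC', hpC'⟩ :=
    exists_isCircuit_of_not_isCocircuit_pair hx hpx.symm hxc (hs x p hpx.symm)
  obtain ⟨q, hqC, hqx, hq⟩ := key C' hC' hxC'
  exact ⟨p, hC.subset_ground hpC, q, hC'.subset_ground hqC, hpx, hqx,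
    fun hpq => hpC' (hpq ▸ hqC), hp, hq⟩

/-! ### Minors of represented matroids -/

theorem IsRep.delete (h : IsRep M v) (X : Set α) : IsRep (M ＼ X) v := by
  intro I
  rw [Matroid.delete_indep_iff, h I, Matroid.delete_ground, Set.subset_sdiff]
  tauto

/-- Only the kernel of `f` matters, so any convenient model of the quotient can be used. -/
theorem IsRep.contract (h : IsRep M v) {X : Set α} (hX : M.Indep X) (f : W →ₗ[ZMod 2] W')
    (hf : LinearMap.ker f = Submodule.span (ZMod 2) (v '' X)) : IsRep (M ／ X) (f ∘ v) := by
  have hX' := ((h X).1 hX).2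
  intro I
  rw [hX.contract_indep_iff, h, Matroid.contract_ground, Set.subset_sdiff]
  by_cases hd : Disjoint I X
  · have h1 : LinearIndepOn (ZMod 2) (f ∘ v) I ↔
        LinearIndepOn (ZMod 2) ((Submodule.span (ZMod 2) (v '' X)).mkQ ∘ v) I := by
      simp only [linearIndepOn_iff_sum_ne_zero, Function.comp, ← map_sum]
      refine forall₂_congr fun C _ => ?_
      rw [← LinearMap.mem_ker, hf, Submodule.mkQ_apply, Submodule.Quotient.mk_eq_zero]
    rw [h1, hX'.quotient_iff_union hd.symm, Set.union_comm X I, Set.union_subset_iff]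
    have := hX.subset_ground
    tauto
  · tauto

end Binary

/-! ### Cycle matroids over the two-element field -/

section CycleMatroid

variable {V β : Type*} {G : Graph V β}

/-- The vector of an edge with the given ends: the sum of the unit vectors of its two ends. -/
noncomputable def edgeVec (z : V × V) : V →₀ ZMod 2 :=
  Finsupp.single z.1 1 + Finsupp.single z.2 1

theorem edgeVec_swap (u v : V) : edgeVec (u, v) = edgeVec (v, u) :=
  add_comm _ _

theorem Joined.edgeVec_mem_span {I : Set β} {z : β → V × V}
    (hz : ∀ e u v, G.IsLink e u v → edgeVec (z e) = edgeVec (u, v)) {u v : V}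
    (h : Joined G I u v) :
    edgeVec (u, v) ∈ Submodule.span (ZMod 2) ((fun e => edgeVec (z e)) '' I) := by
  induction h with
  | refl =>
    have : edgeVec (u, u) = 0 := ZModModule.add_self _
    rw [this]
    exact Submodule.zero_mem _
  | @tail b c _ hbc ih =>
    obtain ⟨e, he, hl⟩ := hbc
    have h1 : edgeVec (u, c) = edgeVec (u, b) + edgeVec (b, c) := by
      have : Finsupp.single b (1 : ZMod 2) + Finsupp.single b 1 = 0 := ZModModule.add_self _
      simp only [edgeVec]
      rw [add_assoc, ← add_assoc (Finsupp.single b 1), this, zero_add]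
    rw [h1]
    exact Submodule.add_mem _ ih (Submodule.subset_span ⟨e, he, hz e _ _ hl⟩)

/-- The indicator of the component of `u` in `I`, extended linearly, vanishes on the edges of `I`;
on `edgeVec (u, v)` it is 1 unless `v` is in that component. -/
theorem joined_of_edgeVec_mem_span {I : Set β} {z : β → V × V}
    (hz : ∀ e u v, G.IsLink e u v → edgeVec (z e) = edgeVec (u, v)) (hI : I ⊆ E(G)) {u v : V}
    (h : edgeVec (u, v) ∈ Submodule.span (ZMod 2) ((fun e => edgeVec (z e)) '' I)) :
    Joined G I u v := by
  classical
  let f : (V →₀ ZMod 2) →ₗ[ZMod 2] ZMod 2 :=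
    Finsupp.linearCombination (ZMod 2) fun w => if Joined G I u w then 1 else 0
  have hle : Submodule.span (ZMod 2) ((fun e => edgeVec (z e)) '' I) ≤ LinearMap.ker f := by
    rw [Submodule.span_le]
    rintro _ ⟨e, he, rfl⟩
    obtain ⟨a, b, hab⟩ := G.exists_isLink_of_mem_edgeSet (hI he)
    have hj : Joined G I u a ↔ Joined G I u b :=
      ⟨fun h => h.trans (.of_link he hab), fun h => h.trans (.of_link he hab.symm)⟩
    have h0 : f (edgeVec (a, b)) = 0 := by
      simp only [f, edgeVec, map_add, Finsupp.linearCombination_single, hj, one_smul]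
      exact ZModModule.add_self (G := ZMod 2) _
    rw [← hz e a b hab] at h0
    exact h0
  have h1 := hle h
  by_contra hj
  have hu : Joined G I u u := .refl
  simp [f, edgeVec, hj, hu] at h1

/-- An edge is a combination of other edges exactly when its ends are joined through them, so
forests are the independent families. -/
theorem isRep_cycleMatroid {z : β → V × V}
    (hz : ∀ e u v, G.IsLink e u v → edgeVec (z e) = edgeVec (u, v)) :
    IsRep (cycleMatroid G) fun e => edgeVec (z e) := by
  intro I
  rw [cycleMatroid_indep, IsForest]
  change _ ↔ I ⊆ E(G) ∧ _
  refine and_congr_right fun hI => ?_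
  rw [LinearIndepOn, linearIndependent_iff_notMem_span]
  have himg : ∀ e : I, (fun i : I => edgeVec (z i)) '' (Set.univ \ {e}) =
      (fun i => edgeVec (z i)) '' (I \ {(e : β)}) := by
    intro e
    ext w
    constructor
    · rintro ⟨i, hi, rfl⟩
      exact ⟨i, ⟨i.2, fun h => hi.2 (Subtype.ext h)⟩, rfl⟩
    · rintro ⟨i, hi, rfl⟩
      exact ⟨⟨i, hi.1⟩, ⟨trivial, fun h => hi.2 (congrArg Subtype.val h)⟩, rfl⟩
  constructor
  · rintro h ⟨e, he⟩ hmem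
    obtain ⟨a, b, hab⟩ := G.exists_isLink_of_mem_edgeSet (hI he)
    rw [himg, hz e a b hab] at hmem
    exact h e he a b hab (joined_of_edgeVec_mem_span hz (Set.sdiff_subset.trans hI) hmem)
  · intro h e he u v hl hj
    apply h ⟨e, he⟩
    rw [himg, hz e u v hl]
    exact hj.edgeVec_mem_span hz

theorem isRep_graphOfEnds {ends : β → Sym2 V} {z : β → V × V}
    (hz : ∀ e, ends e = s((z e).1, (z e).2)) :
    IsRep (cycleMatroid (graphOfEnds ends)) fun e => edgeVec (z e) := by
  refine isRep_cycleMatroid fun e u v hl => ?_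
  have h : s((z e).1, (z e).2) = s(u, v) := (hz e).symm.trans hl
  obtain ⟨h1, h2⟩ | ⟨h1, h2⟩ := Sym2.eq_iff.1 h
  · rw [← h1, ← h2]
  · rw [← h1, ← h2, edgeVec_swap]

theorem exists_isRep_cycleMatroid [Nonempty V] (G : Graph V β) :
    ∃ z : β → V × V, IsRep (cycleMatroid G) fun e => edgeVec (z e) := by
  classical
  have hex : ∀ e, ∃ z : V × V, ∀ u v, G.IsLink e u v → edgeVec z = edgeVec (u, v) := by
    intro e
    by_cases he : e ∈ E(G)
    · obtain ⟨a, b, hab⟩ := G.exists_isLink_of_mem_edgeSet he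
      refine ⟨(a, b), fun u v hl => ?_⟩
      obtain ⟨rfl, rfl⟩ | ⟨rfl, rfl⟩ := hab.eq_and_eq_or_eq_and_eq hl
      · rfl
      · exact edgeVec_swap _ _
    · exact ⟨Classical.arbitrary _, fun u v hl => absurd hl.edge_mem he⟩
  choose z hz using hex
  exact ⟨z, isRep_cycleMatroid hz⟩

end CycleMatroid

/-! ### Element splitting over the two-element field -/

section Splitting

open Classical in
/-- The vectors of the element splitting matroid: an extra coordinate is `1` on `X` and on the new
element. -/
noncomputable def splitVec {α W : Type*} [AddCommGroup W] (v : α → W)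
    (X : Set α) : α ⊕ Unit → W × ZMod 2 :=
  Sum.elim (fun e => (v e, if e ∈ X then 1 else 0)) fun _ => (0, 1)

theorem sum_splitVec_eq_zero_iff {α W : Type*} [AddCommGroup W] (v : α → W)
    (X : Set α) (C : Finset (α ⊕ Unit)) :
    ∑ i ∈ C, splitVec v X i = 0 ↔ ∑ e ∈ C.toLeft, v e = 0 ∧ ∑ i ∈ C, (splitVec v X i).2 = 0 := by
  rw [Prod.ext_iff, Prod.fst_sum, Prod.snd_sum]
  refine and_congr ?_ Iff.rfl
  rw [← C.toLeft_disjSum_toRight, Finset.sum_disjSum]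
  simp [splitVec]

variable {α W : Type*} [AddCommGroup W] [Module (ZMod 2) W] {M : Matroid α} {v : α → W}

theorem isRep_vectorMatroid {m α : Type*} (A : Matrix m α (ZMod 2)) (E : Set α) :
    IsRep (vectorMatroid A E) A.col :=
  fun I => vectorMatroid_indep A E I

theorem IsElementSplitting.ground_eq {X : Set α} {M' : Matroid (α ⊕ Unit)}
    (h : IsElementSplitting M X M') : M'.E = Sum.inl '' M.E ∪ {Sum.inr ()} := by
  obtain ⟨n, A, -, rfl⟩ := h
  rfl

theorem sameSums_col_splittingMatrix {m : Type*} (A : Matrix m α (ZMod 2)) (X : Set α) :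
    SameSums (splitVec A.col X) (splittingMatrix A X).col := by
  let f : (m → ZMod 2) × ZMod 2 →ₗ[ZMod 2] (m ⊕ Unit → ZMod 2) :=
    { toFun := fun p => Sum.elim p.1 fun _ => p.2
      map_add' := fun p q => by ext (i | i) <;> rfl
      map_smul' := fun c p => by ext (i | i) <;> rfl }
  have hf : (splittingMatrix A X).col = f ∘ splitVec A.col X := by
    ext (e | e) (i | i)
    · rfl
    · by_cases he : e ∈ X <;> simp [splittingMatrix, splitVec, f, he]
    · simp [splittingMatrix, splitVec, f]
    · simp [splittingMatrix, splitVec, f]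
  rw [hf]
  refine SameSums.of_injective _ _ fun p _ hp => ?_
  exact Prod.ext (funext fun i => congrFun hp (Sum.inl i)) (congrFun hp (Sum.inr ()))

/-- The matrix behind `M'` is unknown, but by uniqueness its columns have the same zero sums as `v`.
The extra coordinate depends only on `X`, so the splitting does not depend on the representation. -/
theorem IsElementSplitting.isRep (hv : IsRep M v) {X : Set α} {M' : Matroid (α ⊕ Unit)}
    (h : IsElementSplitting M X M') : IsRep M' (splitVec v X) := by
  classical
  have hE := h.ground_eq
  obtain ⟨n, A, hA, rfl⟩ := h
  have hM : IsRep M A.col := by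
    rw [hA]
    exact isRep_vectorMatroid A _
  refine (isRep_vectorMatroid (splittingMatrix A X) _).congr ?_
  intro C
  have h1 := sameSums_col_splittingMatrix A X (C.map ⟨Subtype.val, Subtype.val_injective⟩)
  have h2 := hv.sameSums hM ((C.map ⟨Subtype.val, Subtype.val_injective⟩).toLeft.subtype
    (· ∈ M.E))
  have h3 : ∀ e ∈ (C.map ⟨Subtype.val, Subtype.val_injective⟩).toLeft, e ∈ M.E := by
    intro e he
    simp only [Finset.mem_toLeft, Finset.mem_map, Function.Embedding.coeFn_mk,
      Subtype.exists, exists_and_right, exists_eq_right] at he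
    obtain ⟨he, -⟩ := he
    rw [hE] at he
    simpa using he
  rw [Finset.sum_subtype_of_mem v h3, Finset.sum_subtype_of_mem A.col h3] at h2
  have h4 := sum_splitVec_eq_zero_iff v X (C.map ⟨Subtype.val, Subtype.val_injective⟩)
  have h5 := sum_splitVec_eq_zero_iff A.col X (C.map ⟨Subtype.val, Subtype.val_injective⟩)
  have h6 : ∀ i, (splitVec v X i).2 = (splitVec A.col X i).2 := by rintro (i | i) <;> rfl
  simp only [h6] at h4
  rw [h2, ← h5, h1] at h4
  simpa using h4.symm

theorem exists_isElementSplitting {n : ℕ} {v : α → Fin n → ZMod 2} (hv : IsRep M v) (X : Set α) :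
    ∃ M', IsElementSplitting M X M' := by
  refine ⟨_, n, Matrix.of fun i e => v e i, ?_, rfl⟩
  refine Matroid.ext_indep rfl fun I hI => ?_
  rw [hv, vectorMatroid_indep]
  rfl

end Splitting
/-! ### Recognizing the cycle matroid of the complete graph on five vertices -/

section K5

/-- The ends of the edges of `K₅`. -/
def k5Pair : Fin 10 → Fin 5 × Fin 5 :=
  ![(0, 1), (0, 2), (1, 2), (0, 3), (1, 3), (2, 3), (0, 4), (1, 4), (2, 4), (3, 4)]

/-- The vectors `h i` represent `M(K₅)`, with `h i` in the role of the edge `k5Pair i`. -/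
structure IsK5Config {W : Type*} [AddCommGroup W] (h : Fin 10 → W) : Prop where
  ne_zero : ∀ i, h i ≠ 0
  injective : Function.Injective h
  triangle₀₁₂ : h 0 + h 1 + h 2 = 0
  triangle₀₁₃ : h 0 + h 3 + h 4 = 0
  triangle₀₂₃ : h 1 + h 3 + h 5 = 0
  triangle₀₁₄ : h 0 + h 6 + h 7 = 0
  triangle₀₂₄ : h 1 + h 6 + h 8 = 0
  triangle₀₃₄ : h 3 + h 6 + h 9 = 0

variable {α W : Type*} [AddCommGroup W] [Module (ZMod 2) W] {M : Matroid α} {v : α → W}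

theorem edgeVec_apply {V : Type*} [DecidableEq V] (z : V × V) (a : V) :
    edgeVec z a = (if z.1 = a then 1 else 0) + if z.2 = a then 1 else 0 := by
  simp [edgeVec, Finsupp.single_apply]

theorem isK5Config_edgeVec : IsK5Config fun i => edgeVec (k5Pair i) where
  ne_zero i h := by
    have h1 : ∀ a, ((if (k5Pair i).1 = a then 1 else 0) + if (k5Pair i).2 = a then 1 else 0 :
        ZMod 2) = 0 := fun a => by rw [← edgeVec_apply, h]; rfl
    clear h
    revert i
    decide
  injective i j h := by
    have h1 : ∀ a, ((if (k5Pair i).1 = a then 1 else 0) + if (k5Pair i).2 = a then 1 else 0 :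
        ZMod 2) = ((if (k5Pair j).1 = a then 1 else 0) + if (k5Pair j).2 = a then 1 else 0) :=
      fun a => by rw [← edgeVec_apply, ← edgeVec_apply]; exact congrArg (fun f => f a) h
    clear h
    revert i j
    decide
  triangle₀₁₂ := by
    ext a; simp only [Finsupp.add_apply, edgeVec_apply]; revert a; decide
  triangle₀₁₃ := by
    ext a; simp only [Finsupp.add_apply, edgeVec_apply]; revert a; decide
  triangle₀₂₃ := by
    ext a; simp only [Finsupp.add_apply, edgeVec_apply]; revert a; decide
  triangle₀₁₄ := by
    ext a; simp only [Finsupp.add_apply, edgeVec_apply]; revert a; decide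
  triangle₀₂₄ := by
    ext a; simp only [Finsupp.add_apply, edgeVec_apply]; revert a; decide
  triangle₀₃₄ := by
    ext a; simp only [Finsupp.add_apply, edgeVec_apply]; revert a; decide

theorem IsK5Config.of_sameSums {W' : Type*} [AddCommGroup W'] [Module (ZMod 2) W']
    {k : Fin 10 → W'} {h : Fin 10 → W} (hk : IsK5Config k) (hs : SameSums k h) :
    IsK5Config h where
  ne_zero i hi := hk.ne_zero i (by simpa [hi] using hs {i})
  injective i j hij := by
    by_contra hne
    have h1 := hs {i, j}
    rw [Finset.sum_pair hne, Finset.sum_pair hne, hij, ZModModule.add_self] at h1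
    have h2 := h1.2 rfl
    rw [add_eq_zero_iff_eq_neg, ZModModule.neg_eq_self] at h2
    exact hne (hk.injective h2)
  triangle₀₁₂ := by simpa [add_assoc] using (hs {0, 1, 2}).1 (by simpa [add_assoc] using hk.3)
  triangle₀₁₃ := by simpa [add_assoc] using (hs {0, 3, 4}).1 (by simpa [add_assoc] using hk.4)
  triangle₀₂₃ := by simpa [add_assoc] using (hs {1, 3, 5}).1 (by simpa [add_assoc] using hk.5)
  triangle₀₁₄ := by simpa [add_assoc] using (hs {0, 6, 7}).1 (by simpa [add_assoc] using hk.6)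
  triangle₀₂₄ := by simpa [add_assoc] using (hs {1, 6, 8}).1 (by simpa [add_assoc] using hk.7)
  triangle₀₃₄ := by simpa [add_assoc] using (hs {3, 6, 9}).1 (by simpa [add_assoc] using hk.8)

/-- This is why nonzero and distinct vectors suffice in `IsK5Config`: every nonzero even vector on
five points is an edge or a sum of two distinct edges, so a linear map that separates the edges from
zero and from each other is injective on even vectors. -/
theorem even_vector_cases : ∀ s : Fin 5 → ZMod 2, ∑ a, s a = 0 → s = 0 ∨
    (∃ i, s = fun a => (if (k5Pair i).1 = a then 1 else 0) + if (k5Pair i).2 = a then 1 else 0) ∨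
    ∃ i j, i ≠ j ∧ s = fun a =>
      ((if (k5Pair i).1 = a then 1 else 0) + if (k5Pair i).2 = a then 1 else 0) +
      ((if (k5Pair j).1 = a then 1 else 0) + if (k5Pair j).2 = a then 1 else 0) := by
  decide +kernel

theorem IsK5Config.sum_eq {h : Fin 10 → W} (hh : IsK5Config h) :
    h = ![h 0, h 1, h 0 + h 1, h 3, h 0 + h 3, h 1 + h 3, h 6, h 0 + h 6, h 1 + h 6,
      h 3 + h 6] := by
  have key : ∀ a b c : W, a + b + c = 0 → c = a + b := fun a b c h => by
    rw [add_eq_zero_iff_eq_neg, ZModModule.neg_eq_self] at h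
    exact h.symm
  funext i
  fin_cases i <;> simp [key _ _ _ hh.3, key _ _ _ hh.4, key _ _ _ hh.5, key _ _ _ hh.6,
    key _ _ _ hh.7, key _ _ _ hh.8]

theorem IsK5Config.sameSums {h : Fin 10 → W} (hh : IsK5Config h) :
    SameSums (fun i => edgeVec (k5Pair i)) h := by
  classical
  -- Vertex `0` goes to zero and vertex `i` to the vector of the edge `0i`; the triangles then force
  -- the edge `ij` to go to its vector.
  let T : (Fin 5 →₀ ZMod 2) →ₗ[ZMod 2] W :=
    Finsupp.linearCombination (ZMod 2) ![0, h 0, h 1, h 3, h 6]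
  have hT : ∀ i, T (edgeVec (k5Pair i)) = h i := by
    intro i
    rw [hh.sum_eq]
    fin_cases i <;> simp [T, edgeVec, k5Pair]
  have hT' : h = T ∘ fun i => edgeVec (k5Pair i) := funext fun i => (hT i).symm
  rw [hT']
  refine SameSums.of_injective _ _ fun s hs hs0 => ?_
  have heven : ∑ a, s a = 0 := by
    have hle : Submodule.span (ZMod 2) (Set.range fun i => edgeVec (k5Pair i)) ≤
        LinearMap.ker (Finsupp.linearCombination (ZMod 2) fun _ : Fin 5 => (1 : ZMod 2)) := by
      rw [Submodule.span_le]
      rintro _ ⟨i, rfl⟩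
      simp only [SetLike.mem_coe, LinearMap.mem_ker, edgeVec, map_add,
        Finsupp.linearCombination_single]
      decide
    simpa [Finsupp.linearCombination_apply, Finsupp.sum_fintype] using hle hs
  obtain h0 | ⟨i, hi⟩ | ⟨i, j, hij, hij'⟩ := even_vector_cases s heven
  · exact DFunLike.coe_injective h0
  · have : s = edgeVec (k5Pair i) :=
      Finsupp.ext fun a => by rw [edgeVec_apply]; exact congrFun hi a
    rw [this, hT] at hs0
    exact absurd hs0 (hh.ne_zero i)
  · have : s = edgeVec (k5Pair i) + edgeVec (k5Pair j) := Finsupp.ext fun a => by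
      rw [Finsupp.add_apply, edgeVec_apply, edgeVec_apply]; exact congrFun hij' a
    rw [this, map_add, hT, hT, add_eq_zero_iff_eq_neg, ZModModule.neg_eq_self] at hs0
    exact absurd (hh.injective hs0) hij

/-- The edges of `K₅` in the order of `k5Pair`. -/
noncomputable def k5Equiv : Fin 10 ≃ (⊤ : SimpleGraph (Fin 5)).edgeSet :=
  Equiv.ofBijective
    (fun i => ⟨s((k5Pair i).1, (k5Pair i).2), by
      rw [SimpleGraph.mem_edgeSet, SimpleGraph.top_adj]; revert i; decide⟩)
    ⟨fun i j h => by
      have h1 := congrArg Subtype.val h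
      simp only at h1
      clear h
      revert i j
      decide, by
      rintro ⟨e, he⟩
      have h1 : ∀ a b : Fin 5, a ≠ b → ∃ i, s((k5Pair i).1, (k5Pair i).2) = s(a, b) := by decide
      induction e with
      | h a b =>
        obtain ⟨i, hi⟩ := h1 a b (by simpa using he)
        exact ⟨i, Subtype.ext hi⟩⟩

theorem isRep_K5 : IsRep (cycleMatroid K5) fun e => edgeVec (k5Pair (k5Equiv.symm e)) := by
  refine isRep_graphOfEnds (z := fun e => k5Pair (k5Equiv.symm e)) fun e => ?_
  obtain ⟨i, rfl⟩ := k5Equiv.surjective e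
  rw [Equiv.symm_apply_apply]
  rfl

theorem IsRep.isomorphic_K5_iff (hv : IsRep M v) : Isomorphic M (cycleMatroid K5) ↔
    ∃ g : Fin 10 → α, Function.Injective g ∧ Set.range g = M.E ∧ IsK5Config fun i => v (g i) := by
  rw [hv.isomorphic_iff isRep_K5]
  let κ : Fin 10 ≃ (cycleMatroid K5).E := k5Equiv.trans (Equiv.Set.univ _).symm
  have hκ : ∀ i, edgeVec (k5Pair (k5Equiv.symm (κ i))) = edgeVec (k5Pair i) := fun i =>
    congrArg (fun e => edgeVec (k5Pair e)) (k5Equiv.symm_apply_apply i)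
  constructor
  · rintro ⟨φ, hφ⟩
    let ψ : Fin 10 ≃ M.E := κ.trans φ.symm
    refine ⟨fun i => ψ i, Subtype.val_injective.comp ψ.injective, ?_, ?_⟩
    · change Set.range (Subtype.val ∘ ψ) = _
      rw [Set.range_comp, ψ.range_eq_univ, Set.image_univ, Subtype.range_coe]
    · refine isK5Config_edgeVec.of_sameSums ?_
      have h1 := (hφ.comp ψ.injective).symm
      have h2 : (fun e : M.E => edgeVec (k5Pair (k5Equiv.symm (φ e)))) ∘ ψ =
          fun i => edgeVec (k5Pair i) := by
        funext i
        simp only [Function.comp, ψ, Equiv.trans_apply, Equiv.apply_symm_apply]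
        exact hκ i
      rwa [h2] at h1
  · rintro ⟨g, hg, hgE, hc⟩
    let ψ : Fin 10 ≃ M.E := (Equiv.ofInjective g hg).trans (Equiv.setCongr hgE)
    refine ⟨ψ.symm.trans κ, ?_⟩
    have h1 := (hc.sameSums.comp ψ.symm.injective).symm
    have h2 : (fun i => v (g i)) ∘ ψ.symm = fun e : M.E => v e := by
      funext e
      obtain ⟨i, rfl⟩ := ψ.surjective e
      simp only [Function.comp, Equiv.symm_apply_apply]
      rfl
    rw [h2] at h1
    convert h1 using 1
    funext e
    exact hκ _

/-- A cut of `K₅` does not have three edges. -/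
theorem IsK5Config.card_ne_three {h : Fin 10 → W} (hh : IsK5Config h) (f : W →ₗ[ZMod 2] ZMod 2) :
    ({i | f (h i) = 1} : Finset (Fin 10)).card ≠ 3 := by
  let s : Fin 10 → ZMod 2 := fun i => f (h i)
  have hs : s = ![f (h 0), f (h 1), f (h 0) + f (h 1), f (h 3), f (h 0) + f (h 3),
      f (h 1) + f (h 3), f (h 6), f (h 0) + f (h 6), f (h 1) + f (h 6), f (h 3) + f (h 6)] := by
    funext i
    change f (h i) = _
    conv_lhs => rw [hh.sum_eq]
    fin_cases i <;> simp
  -- The values on the four edges at vertex `0` determine the cut. With `s` vertices on one side it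
  -- has `s (5 - s)` edges, which is 0, 4 or 6.
  have key : ∀ a b c d : ZMod 2, ({i | ![a, b, a + b, c, a + c, b + c, d, a + d, b + d, c + d] i =
      1} : Finset (Fin 10)).card ≠ 3 := by decide +kernel
  change ({i | s i = 1} : Finset (Fin 10)).card ≠ 3
  rw [hs]
  exact key _ _ _ _

end K5
/-! ### The five minors of the element splitting matroid -/

section SplitVec

variable {α W : Type*} [AddCommGroup W] {v : α → W}

theorem splitVec_inl_of_mem {X : Set α} {e : α} (he : e ∈ X) :
    splitVec v X (Sum.inl e) = (v e, 1) := by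
  simp [splitVec, he]

theorem splitVec_inl_of_notMem {X : Set α} {e : α} (he : e ∉ X) :
    splitVec v X (Sum.inl e) = (v e, 0) := by
  simp [splitVec, he]

theorem splitVec_inr {X : Set α} (i : Unit) : splitVec v X (Sum.inr i) = (0, 1) := rfl

theorem exists_isK5Config_iff {γ : Type*} {E : Set γ} {S : Set α} {r : γ → α}
    (hr : Set.BijOn r E S) {w : γ → W} {u : α → W} (hwu : ∀ i ∈ E, w i = u (r i)) :
    (∃ g : Fin 10 → γ, Function.Injective g ∧ Set.range g = E ∧ IsK5Config fun i => w (g i)) ↔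
      ∃ g : Fin 10 → α, Function.Injective g ∧ Set.range g = S ∧ IsK5Config fun i => u (g i) := by
  constructor
  · rintro ⟨g, hg, rfl, hc⟩
    refine ⟨r ∘ g, fun i j hij => hg (hr.injOn ⟨i, rfl⟩ ⟨j, rfl⟩ hij), ?_, ?_⟩
    · rw [Set.range_comp, hr.image_eq]
    · simpa only [hwu _ (Set.mem_range_self _), Function.comp] using hc
  · rintro ⟨g, hg, rfl, hc⟩
    choose s hsE hs using fun i => hr.surjOn (Set.mem_range_self (f := g) i)
    refine ⟨s, fun i j hij => hg (by rw [← hs i, ← hs j, hij]), ?_, ?_⟩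
    · refine subset_antisymm (by rintro _ ⟨i, rfl⟩; exact hsE i) fun e he => ?_
      obtain ⟨i, hi⟩ := hr.mapsTo he
      exact ⟨i, hr.injOn (hsE i) he (by rw [hs, hi])⟩
    · simpa only [hwu _ (hsE _), hs] using hc

end SplitVec

/-! ### Contracting `x`, or `x` and `y`, in the split representation. -/

section Minors

variable {α W : Type*} [AddCommGroup W] [Module (ZMod 2) W] {M : Matroid α} {v : α → W}

/-- The linear map that contracts the vector `(a, 1)`. -/
def contractFst (a : W) : W × ZMod 2 →ₗ[ZMod 2] W :=
  LinearMap.coprod LinearMap.id (LinearMap.toSpanSingleton (ZMod 2) W a)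

theorem contractFst_apply (a w : W) (t : ZMod 2) : contractFst a (w, t) = w + t • a := by
  simp [contractFst]

theorem ker_contractFst (a : W) :
    LinearMap.ker (contractFst a) = Submodule.span (ZMod 2) {(a, (1 : ZMod 2))} := by
  ext ⟨w, t⟩
  rw [LinearMap.mem_ker, contractFst_apply, Submodule.mem_span_singleton,
    add_eq_zero_iff_eq_neg, ZModModule.neg_eq_self]
  constructor
  · rintro rfl
    exact ⟨t, by simp⟩
  · rintro ⟨c, hc⟩
    simp only [Prod.smul_mk, smul_eq_mul, mul_one, Prod.mk.injEq] at hc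
    rw [← hc.1, hc.2]

/-- The quotient map by the line spanned by `a`. -/
abbrev quotLine (a : W) : W →ₗ[ZMod 2] W ⧸ Submodule.span (ZMod 2) {a} :=
  Submodule.mkQ _

theorem ker_quotLine_comp_contractFst (a b : W) :
    LinearMap.ker (quotLine (a + b) ∘ₗ contractFst a) =
      Submodule.span (ZMod 2) {(a, (1 : ZMod 2)), (b, 1)} := by
  ext ⟨w, t⟩
  rw [LinearMap.mem_ker, LinearMap.comp_apply, contractFst_apply, Submodule.mkQ_apply,
    Submodule.Quotient.mk_eq_zero, Submodule.mem_span_singleton, Submodule.mem_span_pair]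
  constructor
  · rintro ⟨c, hc⟩
    refine ⟨t + c, c, ?_⟩
    have h1 : w = c • (a + b) + t • a := by
      rw [hc, add_assoc, ZModModule.add_self, add_zero]
    have h2 : t + c + c = t := by rw [add_assoc, ZModModule.add_self (G := ZMod 2), add_zero]
    simp only [Prod.smul_mk, smul_eq_mul, mul_one, Prod.mk_add_mk, h2, Prod.mk.injEq, and_true]
    rw [h1]
    module
  · rintro ⟨c, d, h⟩
    simp only [Prod.smul_mk, smul_eq_mul, mul_one, Prod.mk_add_mk, Prod.mk.injEq] at h
    obtain ⟨rfl, rfl⟩ := h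
    refine ⟨d, ?_⟩
    have : c • a + d • b + (c + d) • a = d • (a + b) + (c • a + c • a) := by module
    rw [this, ZModModule.add_self, add_zero]

section

variable {x y : α} {M' : Matroid (α ⊕ Unit)}

open Classical in
-- The new element is renamed `x`, since after the contraction its vector is `v x`. The element `x`
-- itself is excluded because its image is zero.
theorem contractFst_splitVec {i : α ⊕ Unit} (hi : i ≠ Sum.inl x) (hxy : x ≠ y) :
    contractFst (v x) (splitVec v {x, y} i) =
      Function.update v y (v x + v y) (Sum.elim id (fun _ => x) i) := by
  obtain e | i := i
  · by_cases hey : e = y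
    · subst hey
      rw [splitVec_inl_of_mem (by simp), contractFst_apply]
      simp [add_comm]
    · have hex : e ≠ x := fun h => hi (h ▸ rfl)
      rw [splitVec_inl_of_notMem (by simp [hex, hey]), contractFst_apply]
      simp [hey]
  · rw [splitVec_inr, contractFst_apply]
    simp [hxy]

theorem quotLine_contractFst_splitVec {i : α ⊕ Unit} (hi : i ≠ Sum.inl x) (hi' : i ≠ Sum.inl y) :
    quotLine (v x + v y) (contractFst (v x) (splitVec v {x, y} i)) =
      quotLine (v x + v y) (v (Sum.elim id (fun _ => x) i)) := by
  obtain e | i := i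
  · have hex : e ≠ x := fun h => hi (h ▸ rfl)
    have hey : e ≠ y := fun h => hi' (h ▸ rfl)
    rw [splitVec_inl_of_notMem (by simp [hex, hey]), contractFst_apply]
    simp
  · rw [splitVec_inr, contractFst_apply]
    simp

variable (hv : IsRep M v) (h : IsElementSplitting M {x, y} M') (hx : x ∈ M.E) (hy : y ∈ M.E)
  (hxy : x ≠ y) (hvxy : v x ≠ v y)

include hv h hx

theorem IsElementSplitting.indep_singleton : M'.Indep {Sum.inl x} := by
  rw [(h.isRep hv).indep_iff (by simp [h.ground_eq, hx]), linearIndepOn_singleton_iff,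
    splitVec_inl_of_mem (by simp)]
  simp

include hvxy

open Classical in
theorem IsElementSplitting.delete_contract_iff :
    Isomorphic (M' ＼ {Sum.inr ()} ／ {Sum.inl x}) (cycleMatroid K5) ↔
      ∃ g : Fin 10 → α, Function.Injective g ∧ Set.range g = M.E \ {x} ∧
        IsK5Config fun i => Function.update v y (v x + v y) (g i) := by
  have hxy : x ≠ y := fun h => hvxy (h ▸ rfl)
  have hi : (M' ＼ {Sum.inr ()}).Indep {Sum.inl x} := by
    rw [Matroid.delete_indep_iff]
    exact ⟨h.indep_singleton hv hx, by simp⟩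
  rw [(((h.isRep hv).delete {Sum.inr ()}).contract hi (contractFst (v x)) (by
    rw [ker_contractFst, Set.image_singleton, splitVec_inl_of_mem (by simp)])).isomorphic_K5_iff]
  refine exists_isK5Config_iff (r := Sum.elim id fun _ => x) ?_ ?_
  · rw [Matroid.contract_ground, Matroid.delete_ground, h.ground_eq]
    refine ⟨?_, ?_, ?_⟩
    · rintro (e | i) <;> simp +contextual
    · rintro (e | i) <;> rintro he (e' | i') <;> simp at he <;> simp +contextual
    · rintro e ⟨he, hex⟩
      exact ⟨Sum.inl e, by simpa using ⟨he, hex⟩, rfl⟩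
  · rintro i hi
    exact contractFst_splitVec hi.2 hxy

open Classical in
-- Compared with `delete_contract_iff`, the new element survives under the name `x`, so the ground
-- set is all of `M.E`.
theorem IsElementSplitting.contract_iff :
    Isomorphic (M' ／ {Sum.inl x}) (cycleMatroid K5) ↔
      ∃ g : Fin 10 → α, Function.Injective g ∧ Set.range g = M.E ∧
        IsK5Config fun i => Function.update v y (v x + v y) (g i) := by
  have hxy : x ≠ y := fun h => hvxy (h ▸ rfl)
  rw [((h.isRep hv).contract (h.indep_singleton hv hx) (contractFst (v x)) (by
    rw [ker_contractFst, Set.image_singleton, splitVec_inl_of_mem (by simp)])).isomorphic_K5_iff]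
  refine exists_isK5Config_iff (r := Sum.elim id fun _ => x) ?_ ?_
  · rw [Matroid.contract_ground, h.ground_eq]
    refine ⟨?_, ?_, ?_⟩
    · rintro (e | i) <;> simp +contextual [hx]
    · rintro (e | i) <;> rintro he (e' | i') <;> simp at he <;> simp +contextual [he, eq_comm]
    · rintro e he
      by_cases hex : e = x
      · exact ⟨Sum.inr (), by simp, hex.symm⟩
      · exact ⟨Sum.inl e, by simpa using ⟨he, hex⟩, rfl⟩
  · rintro i hi
    exact contractFst_splitVec hi.2 hxy

include hy

theorem IsElementSplitting.indep_pair : M'.Indep {Sum.inl x, Sum.inl y} := by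
  have hxy : x ≠ y := fun h => hvxy (h ▸ rfl)
  rw [(h.isRep hv).indep_iff (by
    rw [h.ground_eq]; rintro _ (rfl | rfl) <;> simp [hx, hy]),
    LinearIndepOn.pair_iff _ (by simpa using hxy)]
  intro c d hcd
  rw [splitVec_inl_of_mem (by simp), splitVec_inl_of_mem (by simp)] at hcd
  simp only [Prod.smul_mk, smul_eq_mul, mul_one, Prod.mk_add_mk, Prod.mk_eq_zero] at hcd
  obtain ⟨h1, h2⟩ := hcd
  rw [add_eq_zero_iff_eq_neg, ZModModule.neg_eq_self] at h2
  subst h2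
  rw [← smul_add] at h1
  have : ∀ a : ZMod 2, a = 0 ∨ a = 1 := by decide
  obtain rfl | rfl := this c
  · simp
  · rw [one_smul, add_eq_zero_iff_eq_neg, ZModModule.neg_eq_self] at h1
    exact absurd h1 hvxy

theorem IsElementSplitting.delete_contract_pair_iff :
    Isomorphic (M' ＼ {Sum.inr ()} ／ {Sum.inl x, Sum.inl y}) (cycleMatroid K5) ↔
      ∃ g : Fin 10 → α, Function.Injective g ∧ Set.range g = M.E \ {x, y} ∧
        IsK5Config fun i => quotLine (v x + v y) (v (g i)) := by
  have hi : (M' ＼ {Sum.inr ()}).Indep {Sum.inl x, Sum.inl y} := by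
    rw [Matroid.delete_indep_iff]
    exact ⟨h.indep_pair hv hx hy hvxy, by simp⟩
  rw [(((h.isRep hv).delete {Sum.inr ()}).contract hi
    (quotLine (v x + v y) ∘ₗ contractFst (v x)) (by
    rw [ker_quotLine_comp_contractFst, Set.image_pair, splitVec_inl_of_mem (by simp),
      splitVec_inl_of_mem (by simp)])).isomorphic_K5_iff]
  refine exists_isK5Config_iff (r := Sum.elim id fun _ => x)
    (u := fun e => quotLine (v x + v y) (v e)) ?_ ?_
  · rw [Matroid.contract_ground, Matroid.delete_ground, h.ground_eq]
    refine ⟨?_, ?_, ?_⟩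
    · rintro (e | i) <;> simp +contextual
    · rintro (e | i) <;> rintro he (e' | i') <;> simp at he <;> simp +contextual
    · rintro e ⟨he, hex⟩
      exact ⟨Sum.inl e, by simpa using And.intro he hex, rfl⟩
  · rintro i hi
    exact quotLine_contractFst_splitVec (fun h => hi.2 (h ▸ by simp))
      (fun h => hi.2 (h ▸ by simp))

/-- The new element survives with the common class of `v x` and `v y` and is named `x`; hence only
`y` is missing from the ground set. -/
theorem IsElementSplitting.contract_pair_iff :
    Isomorphic (M' ／ {Sum.inl x, Sum.inl y}) (cycleMatroid K5) ↔
      ∃ g : Fin 10 → α, Function.Injective g ∧ Set.range g = M.E \ {y} ∧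
        IsK5Config fun i => quotLine (v x + v y) (v (g i)) := by
  have hxy : x ≠ y := fun h => hvxy (h ▸ rfl)
  rw [((h.isRep hv).contract (h.indep_pair hv hx hy hvxy)
    (quotLine (v x + v y) ∘ₗ contractFst (v x)) (by
    rw [ker_quotLine_comp_contractFst, Set.image_pair, splitVec_inl_of_mem (by simp),
      splitVec_inl_of_mem (by simp)])).isomorphic_K5_iff]
  refine exists_isK5Config_iff (r := Sum.elim id fun _ => x)
    (u := fun e => quotLine (v x + v y) (v e)) ?_ ?_
  · rw [Matroid.contract_ground, h.ground_eq]
    refine ⟨?_, ?_, ?_⟩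
    · rintro (e | i) <;> simp +contextual [hx, hxy]
    · rintro (e | i) <;> rintro he (e' | i') <;> simp at he <;> simp +contextual [he, eq_comm]
    · rintro e ⟨he, hey⟩
      by_cases hex : e = x
      · exact ⟨Sum.inr (), by simp, hex.symm⟩
      · exact ⟨Sum.inl e, by simpa using ⟨he, hex, hey⟩, rfl⟩
  · rintro i hi
    exact quotLine_contractFst_splitVec (fun h => hi.2 (h ▸ by simp))
      (fun h => hi.2 (h ▸ by simp))

/-- The adjoined row is a functional with value 1 on exactly three elements, `x`, `y` and `a`, which
no cut of `K₅` allows. -/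
theorem IsElementSplitting.not_isomorphic_K5 : ¬ Isomorphic M' (cycleMatroid K5) := by
  have hxy : x ≠ y := fun h => hvxy (h ▸ rfl)
  rw [(h.isRep hv).isomorphic_K5_iff]
  rintro ⟨g, hg, hgE, hc⟩
  have hmem : ∀ i ∈ ({Sum.inl x, Sum.inl y, Sum.inr ()} : Set (α ⊕ Unit)), ∃ j, g j = i := by
    intro i hi
    rw [← Set.mem_range, hgE, h.ground_eq]
    obtain rfl | rfl | rfl := hi <;> simp [hx, hy]
  obtain ⟨i, hi⟩ := hmem (Sum.inl x) (by simp)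
  obtain ⟨j, hj⟩ := hmem (Sum.inl y) (by simp)
  obtain ⟨k, hk⟩ := hmem (Sum.inr ()) (by simp)
  apply hc.card_ne_three (LinearMap.snd (ZMod 2) W (ZMod 2))
  rw [Finset.card_eq_three]
  refine ⟨i, j, k, ?_, ?_, ?_, ?_⟩
  · rintro rfl
    simp [hi, hxy] at hj
  · rintro rfl
    simp [hi] at hk
  · rintro rfl
    simp [hj] at hk
  · ext l
    simp only [Finset.mem_filter, Finset.mem_univ, true_and, Finset.mem_insert,
      Finset.mem_singleton, ← hg.eq_iff (a := l), hi, hj, hk]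
    generalize g l = m
    obtain e | m := m
    · by_cases he : e ∈ ({x, y} : Set α)
      · rw [splitVec_inl_of_mem he]
        simpa using he
      · rw [splitVec_inl_of_notMem he]
        simpa using he
    · simp [splitVec_inr]

end

end Minors
/-! ### Vectors over the two-element field as natural numbers -/

section Codes

/-- The vector whose coordinates are the binary digits of `c`. -/
def bits (c : ℕ) : ℕ → ZMod 2 := fun i => if c.testBit i then 1 else 0

theorem bits_zero : bits 0 = 0 := by
  funext i
  simp [bits]

theorem bits_xor (a b : ℕ) : bits (a ^^^ b) = bits a + bits b := by
  funext i
  simp only [bits, Nat.testBit_xor, Pi.add_apply]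
  cases a.testBit i <;> cases b.testBit i <;> decide

theorem bits_injective : Function.Injective bits := by
  intro a b h
  refine Nat.eq_of_testBit_eq fun i => ?_
  have h1 := congrFun h i
  revert h1
  simp only [bits]
  cases a.testBit i <;> cases b.testBit i <;> decide

theorem bits_eq_zero_iff {c : ℕ} : bits c = 0 ↔ c = 0 := by
  rw [← bits_zero, bits_injective.eq_iff]

/-- The numbers `h i` encode a copy of `M(K₅)` in the quotient by the vectors encoded by `ks`. -/
structure CodeConfig (ks : List ℕ) (h : Fin 10 → ℕ) : Prop where
  notMem : ∀ i, h i ∉ ks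
  xor_notMem : ∀ i j, i ≠ j → h i ^^^ h j ∉ ks
  triangle₀₁₂ : h 0 ^^^ h 1 ^^^ h 2 ∈ ks
  triangle₀₁₃ : h 0 ^^^ h 3 ^^^ h 4 ∈ ks
  triangle₀₂₃ : h 1 ^^^ h 3 ^^^ h 5 ∈ ks
  triangle₀₁₄ : h 0 ^^^ h 6 ^^^ h 7 ∈ ks
  triangle₀₂₄ : h 1 ^^^ h 6 ^^^ h 8 ∈ ks
  triangle₀₃₄ : h 3 ^^^ h 6 ^^^ h 9 ∈ ks

theorem isK5Config_iff_codeConfig {W : Type*} [AddCommGroup W] [Module (ZMod 2) W]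
    {f : (ℕ → ZMod 2) →ₗ[ZMod 2] W} {ks : List ℕ} (hf : ∀ c, f (bits c) = 0 ↔ c ∈ ks)
    {h : Fin 10 → ℕ} : IsK5Config (fun i => f (bits (h i))) ↔ CodeConfig ks h := by
  have h2 : ∀ i j, h i ^^^ h j ∈ ks ↔ f (bits (h i)) = f (bits (h j)) := fun i j => by
    rw [← hf, bits_xor, map_add, add_eq_zero_iff_eq_neg, ZModModule.neg_eq_self]
  have h3 : ∀ i j k, h i ^^^ h j ^^^ h k ∈ ks ↔
      f (bits (h i)) + f (bits (h j)) + f (bits (h k)) = 0 := fun i j k => by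
    rw [← hf, bits_xor, bits_xor, map_add, map_add]
  constructor
  · rintro ⟨a, b, t1, t2, t3, t4, t5, t6⟩
    exact ⟨fun i hi => a i ((hf _).2 hi), fun i j hij hm => hij (b ((h2 i j).1 hm)),
      (h3 _ _ _).2 t1,
      (h3 _ _ _).2 t2, (h3 _ _ _).2 t3, (h3 _ _ _).2 t4, (h3 _ _ _).2 t5, (h3 _ _ _).2 t6⟩
  · rintro ⟨a, b, t1, t2, t3, t4, t5, t6⟩
    exact ⟨fun i hi => a i ((hf _).1 hi), fun i j hij => by
        by_contra hne
        exact b i j hne ((h2 i j).2 hij), (h3 _ _ _).1 t1,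
      (h3 _ _ _).1 t2, (h3 _ _ _).1 t3, (h3 _ _ _).1 t4, (h3 _ _ _).1 t5, (h3 _ _ _).1 t6⟩

theorem isK5Config_bits_iff {h : Fin 10 → ℕ} :
    IsK5Config (fun i => bits (h i)) ↔ CodeConfig [0] h :=
  isK5Config_iff_codeConfig (f := LinearMap.id) fun c => by simp [bits_eq_zero_iff]

theorem isK5Config_quotLine_iff {e : ℕ} {h : Fin 10 → ℕ} :
    IsK5Config (fun i => quotLine (bits e) (bits (h i))) ↔ CodeConfig [0, e] h := by
  refine isK5Config_iff_codeConfig fun c => ?_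
  rw [Submodule.mkQ_apply, Submodule.Quotient.mk_eq_zero, Submodule.mem_span_singleton]
  have : ∀ a : ZMod 2, a = 0 ∨ a = 1 := by decide
  simp only [List.mem_cons, List.not_mem_nil, or_false]
  constructor
  · rintro ⟨a, ha⟩
    obtain rfl | rfl := this a
    · rw [zero_smul, eq_comm, bits_eq_zero_iff] at ha
      exact .inl ha
    · rw [one_smul, bits_injective.eq_iff] at ha
      exact .inr ha.symm
  · rintro (rfl | rfl)
    · exact ⟨0, by rw [zero_smul, bits_zero]⟩
    · exact ⟨1, one_smul _ _⟩

/-- The action on the edges of `K₅` of the transposition of the vertices `1` and `2`. -/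
def swap₁₂ : Equiv.Perm (Fin 10) :=
  Equiv.swap 0 1 * Equiv.swap 4 5 * Equiv.swap 7 8

/-- The action on the edges of `K₅` of the transposition of the vertices `2` and `3`. -/
def swap₂₃ : Equiv.Perm (Fin 10) :=
  Equiv.swap 1 3 * Equiv.swap 2 4 * Equiv.swap 8 9

/-- The action on the edges of `K₅` of the transposition of the vertices `3` and `4`. -/
def swap₃₄ : Equiv.Perm (Fin 10) :=
  Equiv.swap 3 6 * Equiv.swap 4 7 * Equiv.swap 5 8

theorem CodeConfig.comp {ks : List ℕ} {h : Fin 10 → ℕ} (hh : CodeConfig ks h)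
    {τ : Equiv.Perm (Fin 10)} (hτ : τ = swap₁₂ ∨ τ = swap₂₃ ∨ τ = swap₃₄) :
    CodeConfig ks (h ∘ τ) := by
  have h1 : ∀ i, (h ∘ τ) i ∉ ks := fun i => hh.notMem _
  have h2 : ∀ i j, i ≠ j → (h ∘ τ) i ^^^ (h ∘ τ) j ∉ ks :=
    fun i j hij => hh.xor_notMem _ _ fun h => hij (τ.injective h)
  obtain ⟨-, -, t1, t2, t3, t4, t5, t6⟩ := hh
  have hc : ∀ a b c : ℕ, a ^^^ b ^^^ c ∈ ks → b ^^^ a ^^^ c ∈ ks := fun a b c h => by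
    rwa [Nat.xor_comm b a]
  obtain rfl | rfl | rfl := hτ
  · exact ⟨h1, h2, hc _ _ _ t1, t3, t2, t5, t4, t6⟩
  · exact ⟨h1, h2, t2, t1, hc _ _ _ t3, t4, t6, t5⟩
  · exact ⟨h1, h2, t1, t4, t5, t2, t3, hc _ _ _ t6⟩

theorem CodeConfig.exists_sorted {ks : List ℕ} (h0 : 0 ∈ ks) {h : Fin 10 → ℕ}
    (hh : CodeConfig ks h) : ∃ τ : Equiv.Perm (Fin 10), CodeConfig ks (h ∘ τ) ∧
      h (τ 0) < h (τ 1) ∧ h (τ 1) < h (τ 3) ∧ h (τ 3) < h (τ 6) := by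
  -- With the weights 4, 3, 2, 1 an adjacent transposition lowers the total precisely when it
  -- removes an inversion, so a minimizer is sorted. The inequalities are strict because distinct
  -- entries differ when `0 ∈ ks`.
  obtain ⟨τ, hτ, hmin⟩ := Set.exists_min_image {τ : Equiv.Perm (Fin 10) | CodeConfig ks (h ∘ τ)}
    (fun τ => 4 * h (τ 0) + 3 * h (τ 1) + 2 * h (τ 3) + h (τ 6)) (Set.toFinite _)
    ⟨1, by simpa using hh⟩
  have hne : ∀ i j, i ≠ j → h (τ i) ≠ h (τ j) := fun i j hij he =>
    hτ.xor_notMem i j hij (by simpa [Function.comp, he] using h0)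
  have h1 : _ ≤ 4 * h (τ 1) + 3 * h (τ 0) + 2 * h (τ 3) + h (τ 6) :=
    hmin (τ * swap₁₂) (hτ.comp (.inl rfl))
  have h2 : _ ≤ 4 * h (τ 0) + 3 * h (τ 3) + 2 * h (τ 1) + h (τ 6) :=
    hmin (τ * swap₂₃) (hτ.comp (.inr (.inl rfl)))
  have h3 : _ ≤ 4 * h (τ 0) + 3 * h (τ 1) + 2 * h (τ 6) + h (τ 3) :=
    hmin (τ * swap₃₄) (hτ.comp (.inr (.inr rfl)))
  have n1 := hne 0 1 (by decide)
  have n2 := hne 1 3 (by decide)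
  have n3 := hne 3 6 (by decide)
  exact ⟨τ, hτ, by omega, by omega, by omega⟩

/-! ### The finite search -/

/-- Boolean membership in a list of numbers. -/
def elem (l : List ℕ) (c : ℕ) : Bool := l.any (Nat.beq c)

theorem elem_iff {l : List ℕ} {c : ℕ} : elem l c = true ↔ c ∈ l := by
  simp [elem]

/-- Insertion in a sorted list. -/
def insertNat (a : ℕ) : List ℕ → List ℕ
  | [] => [a]
  | b :: l => bif Nat.ble a b then a :: b :: l else b :: insertNat a l

/-- Insertion sort. -/
def sortNat : List ℕ → List ℕ
  | [] => []
  | a :: l => insertNat a (sortNat l)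

theorem insertNat_perm (a : ℕ) (l : List ℕ) : (insertNat a l).Perm (a :: l) := by
  induction l with
  | nil => exact .refl _
  | cons b l ih =>
    rw [insertNat]
    cases Nat.ble a b
    · exact (ih.cons b).trans (.swap a b l)
    · exact .refl _

theorem sortNat_perm (l : List ℕ) : (sortNat l).Perm l := by
  induction l with
  | nil => exact .refl _
  | cons a l ih => exact (insertNat_perm a _).trans (ih.cons a)

/-- All members of `l` that satisfy `p` satisfy `q`. -/
def allSuch (l : List ℕ) (p q : ℕ → Bool) : Bool := l.all fun a => bif p a then q a else true

theorem allSuch.apply {l : List ℕ} {p q : ℕ → Bool} (h : allSuch l p q = true) {a : ℕ}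
    (ha : a ∈ l) (hp : p a = true) : q a = true := by
  have h1 := List.all_eq_true.1 h a ha
  simpa [hp] using h1

/-- None of the sums of `c` with the members of `l` is in `ks`. -/
def apart (ks l : List ℕ) (c : ℕ) : Bool :=
  l.all fun b => bif elem ks (Nat.xor b c) then false else true

/-- All configurations whose entries are allowed by `ok` and come from `cand`, with the edges at the
vertex `0` in increasing order, satisfy `leaf`. -/
def search (ks cand : List ℕ) (ok : ℕ → ℕ → Bool) (leaf : List ℕ → Bool) : Bool :=
  allSuch cand (fun a => ok 0 a && apart ks [0] a) fun a =>
  allSuch cand (fun b => Nat.blt a b && ok 1 b && apart ks [0, a] b) fun b =>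
  -- The edges `a`, `b`, `d`, `g` at vertex `0` are chosen freely. Each of the other six closes a
  -- triangle and so is known up to a member `k` of `ks`.
  allSuch ks (fun k => ok 2 (Nat.xor (Nat.xor a b) k)) fun k =>
  (fun c => allSuch cand (fun d => Nat.blt b d && ok 3 d && apart ks [0, a, b, c] d) fun d =>
    allSuch ks (fun k => ok 4 (Nat.xor (Nat.xor a d) k)) fun k =>
    (fun e => allSuch ks (fun k => ok 5 (Nat.xor (Nat.xor b d) k)) fun k =>
      (fun f => allSuch cand
          (fun g => Nat.blt d g && ok 6 g && apart ks [0, a, b, c, d, e, f] g) fun g =>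
        allSuch ks (fun k => ok 7 (Nat.xor (Nat.xor a g) k)) fun k =>
        (fun h => allSuch ks (fun k => ok 8 (Nat.xor (Nat.xor b g) k)) fun k =>
          (fun i => allSuch ks (fun k => ok 9 (Nat.xor (Nat.xor d g) k) &&
              apart ks [c] (Nat.xor (Nat.xor d g) k)) fun k =>
            leaf [a, b, c, d, e, f, g, h, i, Nat.xor (Nat.xor d g) k])
            (Nat.xor (Nat.xor b g) k))
          (Nat.xor (Nat.xor a g) k))
        (Nat.xor (Nat.xor b d) k))
      (Nat.xor (Nat.xor a d) k))
    (Nat.xor (Nat.xor a b) k)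

/-- The tests in `search` are only some consequences of `CodeConfig`, enough for pruning;
completeness of the enumeration is all that is needed. Each triangle condition says which `k`
recovers the actual entry. -/
theorem leaf_eq_true_of_search {ks cand : List ℕ} {ok : ℕ → ℕ → Bool} {leaf : List ℕ → Bool}
    (hs : search ks cand ok leaf = true) {h : Fin 10 → ℕ} (hh : CodeConfig ks h)
    (hcand : ∀ i, h i ∈ cand) (hok : ∀ i : Fin 10, ok i (h i) = true)
    (h01 : h 0 < h 1) (h13 : h 1 < h 3) (h36 : h 3 < h 6) : leaf (List.ofFn h) = true := by
  have hx : ∀ a b c : ℕ, Nat.xor (Nat.xor a b) (a ^^^ b ^^^ c) = c := fun a b c => by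
    change a ^^^ b ^^^ (a ^^^ b ^^^ c) = c
    rw [← Nat.xor_assoc, Nat.xor_self, Nat.zero_xor]
  have hlt : ∀ {a b : ℕ}, a < b → Nat.blt a b = true := fun h => by simpa [Nat.blt_eq] using h
  have he : ∀ i, elem ks (h i) = false := fun i => by
    rw [Bool.eq_false_iff, ne_eq, elem_iff]
    exact hh.notMem i
  have he2 : ∀ i j, i ≠ j → elem ks (h i ^^^ h j) = false := fun i j hij => by
    rw [Bool.eq_false_iff, ne_eq, elem_iff]
    exact hh.xor_notMem i j hij
  have o0 : ok 0 (h 0) = true := hok 0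
  have o1 : ok 1 (h 1) = true := hok 1
  have o3 : ok 3 (h 3) = true := hok 3
  have o6 : ok 6 (h 6) = true := hok 6
  have o9 : ok 9 (h 9) = true := hok 9
  have k1 := allSuch.apply hs (hcand 0) (by simp [apart, o0, he])
  have k2 := allSuch.apply k1 (hcand 1) (by
    simp [apart, hlt h01, o1, he, he2 0 1])
  have k3 := allSuch.apply k2 hh.triangle₀₁₂ (by rw [hx]; exact hok 2)
  rw [hx] at k3
  have k4 := allSuch.apply k3 (hcand 3) (by
    simp [apart, hlt h13, o3, he, he2 0 3, he2 1 3, he2 2 3])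
  have k5 := allSuch.apply k4 hh.triangle₀₁₃ (by rw [hx]; exact hok 4)
  rw [hx] at k5
  have k6 := allSuch.apply k5 hh.triangle₀₂₃ (by rw [hx]; exact hok 5)
  rw [hx] at k6
  have k7 := allSuch.apply k6 (hcand 6) (by
    simp [apart, hlt h36, o6, he, he2 0 6, he2 1 6, he2 2 6, he2 3 6, he2 4 6, he2 5 6])
  have k8 := allSuch.apply k7 hh.triangle₀₁₄ (by rw [hx]; exact hok 7)
  rw [hx] at k8
  have k9 := allSuch.apply k8 hh.triangle₀₂₄ (by rw [hx]; exact hok 8)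
  rw [hx] at k9
  have k10 := allSuch.apply k9 hh.triangle₀₃₄ (by
    rw [hx]
    simp [apart, o9, he2 2 9])
  rw [hx] at k10
  exact k10

/-- The codes of the pairs from a set of five vertices. -/
def codes5 : List ℕ := [3, 5, 6, 9, 10, 12, 17, 18, 20, 24]

/-- The codes of the pairs from a set of six vertices. -/
def codes6 : List ℕ := [3, 5, 6, 9, 10, 12, 17, 18, 20, 24, 33, 34, 36, 40, 48]

/-- Every vertex in `vs` has degree at least three. -/
def degreeOK (vs L : List ℕ) : Bool :=
  vs.all fun i => Nat.ble 3 (L.countP fun c => c.testBit i)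

/-- The codes `L` form, up to their order, one of the lists in `goods`. -/
def isGood (goods : List (List ℕ)) (L : List ℕ) : Bool :=
  goods.contains (sortNat L)

end Codes
-- The graphs as lists of codes, and the four exhaustive searches.
section FiniteSearch

/-- The ends of the edges of `G11`. -/
def pairs₁₁ : Fin 11 → Fin 5 × Fin 5 :=
  ![(0, 1), (0, 1), (0, 2), (0, 2), (0, 3), (0, 4), (1, 3), (1, 4), (2, 3), (2, 4), (3, 4)]

/-- The sorted codes of the relabelings of `G11` that the search meets. -/
def codes₁₁ : List (List ℕ) :=
  [[3, 3, 6, 6, 9, 10, 12, 17, 18, 20, 24]]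

/-- The ends of the edges of `G12`. -/
def pairs₁₂ : Fin 12 → Fin 6 × Fin 6 :=
  ![(0, 1), (0, 3), (0, 4), (0, 5), (1, 3), (1, 4), (1, 5), (2, 4), (2, 4), (2, 5), (3, 4), (4,
  5)]

/-- The sorted codes of the relabelings of `G12` that the search meets. -/
def codes₁₂ : List (List ℕ) :=
  [[3, 3, 6, 9, 10, 18, 20, 24, 34, 36, 40, 48], [3, 3, 6, 10, 12, 17, 18, 24, 34, 36, 40, 48],
  [3, 3, 6, 10, 12, 18, 20, 24, 33, 34, 40, 48], [3, 6, 6, 9, 10, 17, 18, 24, 34, 36, 40, 48],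
  [3, 6, 6, 9, 10, 18, 20, 24, 33, 34, 40, 48], [3, 6, 6, 10, 12, 17, 18, 24, 33, 34, 40, 48]]

/-- The ends of the edges of `G13`. -/
def pairs₁₃ : Fin 12 → Fin 6 × Fin 6 :=
  ![(0, 1), (0, 3), (0, 4), (0, 5), (1, 3), (1, 4), (1, 5), (2, 4), (2, 5), (2, 5), (3, 4), (4,
  5)]

/-- The sorted codes of the relabelings of `G13` that the search meets. -/
def codes₁₃ : List (List ℕ) :=
  [[3, 3, 5, 6, 12, 17, 20, 24, 33, 36, 40, 48], [3, 3, 5, 6, 12, 18, 20, 24, 34, 36, 40, 48],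
  [3, 3, 9, 10, 12, 17, 20, 24, 33, 36, 40, 48], [3, 3, 9, 10, 12, 18, 20, 24, 34, 36, 40, 48],
  [3, 5, 9, 12, 12, 17, 18, 20, 33, 34, 36, 48], [3, 5, 9, 12, 12, 17, 18, 24, 33, 34, 40, 48],
  [3, 6, 10, 12, 12, 17, 18, 20, 33, 34, 36, 48], [3, 6, 10, 12, 12, 17, 18, 24, 33, 34, 40,
  48]]

/-- The ends of the edges of `G14`. -/
def pairs₁₄ : Fin 12 → Fin 6 × Fin 6 :=
  ![(0, 1), (0, 2), (0, 3), (1, 2), (1, 3), (2, 3), (2, 4), (3, 4), (0, 5), (1, 5), (4, 5), (4,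
  5)]

/-- The sorted codes of the relabelings of `G14` that the search meets. -/
def codes₁₄ : List (List ℕ) :=
  [[3, 3, 5, 9, 12, 18, 20, 24, 34, 36, 40, 48], [3, 3, 6, 10, 12, 17, 20, 24, 33, 36, 40, 48],
  [3, 5, 6, 12, 12, 17, 18, 24, 33, 34, 40, 48], [3, 9, 10, 12, 12, 17, 18, 20, 33, 34, 36, 48]]

/-- The ends of the edges of `G15`. -/
def pairs₁₅ : Fin 12 → Fin 6 × Fin 6 :=
  ![(0, 1), (0, 1), (0, 2), (0, 3), (1, 2), (1, 3), (2, 3), (2, 4), (3, 4), (0, 5), (1, 5), (4,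
  5)]

/-- The sorted codes of the relabelings of `G15` that the search meets. -/
def codes₁₅ : List (List ℕ) :=
  [[3, 3, 5, 6, 12, 17, 18, 24, 33, 34, 40, 48], [3, 3, 9, 10, 12, 17, 18, 20, 33, 34, 36, 48],
  [3, 5, 9, 12, 12, 18, 20, 24, 34, 36, 40, 48], [3, 6, 10, 12, 12, 17, 20, 24, 33, 36, 40, 48]]

/-- The ends of the edges of `G16`. -/
def pairs₁₆ : Fin 10 → Fin 5 × Fin 5 :=
  ![(0, 1), (0, 1), (0, 2), (0, 3), (0, 4), (1, 3), (1, 4), (2, 3), (2, 4), (3, 4)]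

/-- The sorted codes of the relabelings of `G16` that the search meets. -/
def codes₁₆ : List (List ℕ) :=
  [[3, 6, 6, 9, 10, 12, 17, 18, 20, 24]]

/-- The ends of the edges of `G17`. -/
def pairs₁₇ : Fin 11 → Fin 6 × Fin 6 :=
  ![(0, 3), (0, 4), (0, 5), (1, 3), (1, 4), (1, 5), (2, 3), (2, 4), (2, 5), (0, 1), (3, 4)]

/-- The sorted codes of the relabelings of `G17` that the search meets. -/
def codes₁₇ : List (List ℕ) :=
  [[3, 5, 6, 12, 17, 18, 24, 33, 34, 40, 48], [3, 5, 9, 12, 18, 20, 24, 34, 36, 40, 48], [3, 6,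
  10, 12, 17, 20, 24, 33, 36, 40, 48], [3, 9, 10, 12, 17, 18, 20, 33, 34, 36, 48]]

/-- The search for configurations in which the codes `3` and `y` stand for `x` and `y`, in the
quotient by the line through their sum. -/
def quotLeaf (y : ℕ) (vs : List ℕ) (goods goods' : List (List ℕ)) (L : List ℕ) : Bool :=
  (bif degreeOK vs (3 :: y :: L) then isGood goods (3 :: y :: L) else true) &&
    (bif elem L 3 && degreeOK vs (y :: L) then isGood goods' (y :: L) else true)

/-- `5 = 3 ^^^ 6`: here `x = 01` and `y = 12`, and the quotient identifies vertices 0 and 2. The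
empty second list says that `M' ／ {x, y}` gives nothing in this position. -/
theorem search_quot_six : search [0, 5] codes6 (fun _ => elem codes6)
    (quotLeaf 6 [0, 1, 2] codes₁₂ []) = true := by
  decide +kernel

/-- `15 = 3 ^^^ 12`: here `x = 01` and `y = 23`, and the quotient identifies complementary pairs
inside `{0, 1, 2, 3}`. -/
theorem search_quot_twelve : search [0, 15] codes6 (fun _ => elem codes6)
    (quotLeaf 12 [0, 1, 2, 3] (codes₁₃ ++ codes₁₄ ++ codes₁₅) codes₁₇) = true := by
  decide +kernel

/-- The search for configurations in which the entry `i₀` is the sum of the vectors of `x` and `y`,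
encoded by `3` and `y`. -/
def twistLeaf (y i₀ : ℕ) (goods goods' : List (List ℕ)) (L : List ℕ) : Bool :=
  isGood goods (3 :: L.set i₀ y) &&
    (bif elem (L.set i₀ y) 3 then isGood goods' (L.set i₀ y) else true)

/-- The entries allowed in a configuration whose entry `i₀` is `e`. -/
def twistOK (e i₀ i c : ℕ) : Bool :=
  bif Nat.beq i i₀ then Nat.beq c e else elem codes5 c

/-- The moved `y` is the edge 02, so the ten distinct entries are all the edges on five vertices.
Moving `y` back turns 5 into a second 6, which is `G16`; adding `x` gives `G11`. -/
theorem search_twist_six : ∀ i₀ < 10, search [0] codes5 (twistOK 5 i₀)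
    (twistLeaf 6 i₀ codes₁₁ codes₁₆) = true := by
  decide +kernel

/-- No configuration exists. The ten vectors of `M(K₅)` sum to zero, and so do the ten codes in
`codes5`; replacing an edge by 15, which is not an edge, destroys this. -/
theorem search_twist_twelve : ∀ i₀ < 10, search [0] (15 :: codes5) (twistOK 15 i₀)
    (twistLeaf 12 i₀ [] []) = true := by
  decide +kernel

end FiniteSearch
/-! ### Counting in lists -/

section Lists

theorem countP_ofFn {n : ℕ} {X : Type*} (f : Fin n → X) (p : X → Bool) :
    (List.ofFn f).countP p = (Finset.univ.filter fun i => p (f i) = true).card := by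
  have h : (List.ofFn f).countP p = Multiset.countP (fun a => p a = true) (List.ofFn f) := by
    simp [Multiset.coe_countP]
  rw [h, ← Fin.univ_val_map, Multiset.countP_map]
  rfl

theorem three_le_countP_ofFn {n : ℕ} {X : Type*} {f : Fin n → X} {p : X → Bool} {i j k : Fin n}
    (hij : i ≠ j) (hik : i ≠ k) (hjk : j ≠ k) (hi : p (f i) = true) (hj : p (f j) = true)
    (hk : p (f k) = true) : 3 ≤ (List.ofFn f).countP p := by
  rw [countP_ofFn]
  have h : ({i, j, k} : Finset (Fin n)) ⊆ Finset.univ.filter fun i => p (f i) = true := by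
    intro l hl
    simp only [Finset.mem_insert, Finset.mem_singleton] at hl
    obtain rfl | rfl | rfl := hl <;> simp [hi, hj, hk]
  calc 3 = ({i, j, k} : Finset (Fin n)).card := by rw [Finset.card_eq_three.2 ⟨i, j, k, hij, hik,
    hjk, rfl⟩]
    _ ≤ _ := Finset.card_le_card h

theorem exists_equiv_of_perm_ofFn {n : ℕ} {X : Type*} [DecidableEq X] {f g : Fin n → X}
    (h : (List.ofFn f).Perm (List.ofFn g)) : ∃ τ : Fin n ≃ Fin n, ∀ i, f i = g (τ i) := by
  have hcard : ∀ c, Fintype.card {i // f i = c} = Fintype.card {i // g i = c} := by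
    intro c
    have h1 := h.countP_eq fun a => decide (a = c)
    rw [countP_ofFn, countP_ofFn] at h1
    simpa [Fintype.card_subtype] using h1
  exact ⟨Equiv.ofFiberEquiv fun c => Fintype.equivOfCardEq (hcard c),
    fun i => (Equiv.ofFiberEquiv_map _ i).symm⟩

end Lists

/-! ### Graphic matroids of small rank -/

section SmallRank

variable {α β V ι W W' : Type*} [AddCommGroup W] [Module (ZMod 2) W]
  [AddCommGroup W'] [Module (ZMod 2) W']

/-- The code of a pair of vertices. -/
def edgeCode {n : ℕ} (z : Fin n × Fin n) : ℕ := 2 ^ (z.1 : ℕ) ^^^ 2 ^ (z.2 : ℕ)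

theorem sameSums_bits_edgeCode {n : ℕ} (z : ι → Fin n × Fin n) :
    SameSums (fun i => edgeVec (z i)) fun i => bits (edgeCode (z i)) := by
  let T : (Fin n →₀ ZMod 2) →ₗ[ZMod 2] (ℕ → ZMod 2) :=
    Finsupp.linearCombination (ZMod 2) fun i => bits (2 ^ (i : ℕ))
  have hT : (fun i => bits (edgeCode (z i))) = T ∘ fun i => edgeVec (z i) := by
    funext i
    simp [T, edgeVec, edgeCode, bits_xor]
  rw [hT]
  refine SameSums.of_injective _ _ fun s _ hs => Finsupp.ext fun j => ?_
  have h1 := congrFun hs j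
  rw [Finsupp.linearCombination_apply, Finsupp.sum_fintype _ _ (by simp), Finset.sum_apply,
    Finset.sum_eq_single j] at h1
  · simpa [bits] using h1
  · intro i _ hij
    have : (i : ℕ) ≠ j := fun h => hij (Fin.ext h)
    simp [bits, this]
  · simp

/-- A coordinate that is nonzero on some vector of `S` cuts out a subspace of smaller dimension;
iterate. -/
theorem exists_coordinates {n : ℕ} (S : Submodule (ZMod 2) (V →₀ ZMod 2))
    [FiniteDimensional (ZMod 2) S]
    (hS : Module.finrank (ZMod 2) S ≤ n) :
    ∃ B : Finset V, B.card ≤ n ∧ ∀ s ∈ S, (∀ b ∈ B, s b = 0) → s = 0 := by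
  classical
  induction n generalizing S with
  | zero =>
    refine ⟨∅, le_rfl, fun s hs _ => ?_⟩
    rw [Submodule.finrank_eq_zero.1 (Nat.le_zero.1 hS)] at hs
    exact (Submodule.mem_bot _).1 hs
  | succ n ih =>
    by_cases hbot : S = ⊥
    · subst hbot
      exact ⟨∅, Nat.zero_le _, fun s hs _ => (Submodule.mem_bot _).1 hs⟩
    obtain ⟨s, hs, hs0⟩ := Submodule.exists_mem_ne_zero_of_ne_bot hbot
    obtain ⟨b, hb⟩ := Finsupp.ne_iff.1 hs0
    have hlt : S ⊓ LinearMap.ker (Finsupp.lapply (R := ZMod 2) (M := ZMod 2) b) < S := by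
      refine lt_of_le_of_ne inf_le_left fun h => hb ?_
      rw [← h] at hs
      exact hs.2
    have : FiniteDimensional (ZMod 2)
        ↥(S ⊓ LinearMap.ker (Finsupp.lapply (R := ZMod 2) (M := ZMod 2) b)) :=
      Submodule.finiteDimensional_of_le hlt.le
    obtain ⟨B, hB, hBS⟩ := ih _ (Nat.le_of_lt_succ
      ((Submodule.finrank_lt_finrank_of_lt hlt).trans_le hS))
    refine ⟨insert b B, (Finset.card_insert_le _ _).trans (Nat.succ_le_succ hB), fun t ht htB => ?_⟩
    exact hBS t ⟨ht, htB b (Finset.mem_insert_self _ _)⟩ fun c hc =>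
      htB c (Finset.mem_insert_of_mem hc)

/-- A family of edge vectors of rank at most `n` is, up to a linear isomorphism, a family of edge
vectors of a graph with `n + 1` vertices. -/
theorem exists_sameSums_fin {n : ℕ} (z : ι → V × V) (t : Fin n → V →₀ ZMod 2)
    (ht : ∀ i, edgeVec (z i) ∈ Submodule.span (ZMod 2) (Set.range t)) :
    ∃ π : V → Fin (n + 1),
      SameSums (fun i => edgeVec (z i)) fun i => edgeVec (Prod.map π π (z i)) := by
  classical
  have hle : Submodule.span (ZMod 2) (Set.range fun i => edgeVec (z i)) ≤
      Submodule.span (ZMod 2) (Set.range t) := by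
    rw [Submodule.span_le]
    rintro _ ⟨i, rfl⟩
    exact ht i
  have hfin : FiniteDimensional (ZMod 2) (Submodule.span (ZMod 2) (Set.range t)) :=
    FiniteDimensional.span_of_finite _ (Set.finite_range t)
  have hfr : Module.finrank (ZMod 2) (Submodule.span (ZMod 2) (Set.range t)) ≤ n := by
    have h := finrank_range_le_card (R := ZMod 2) t
    rwa [Fintype.card_fin] at h
  obtain ⟨B, hB, hBS⟩ := exists_coordinates _ hfr
  have hemb : Nonempty (B ↪ Fin n) :=
    Function.Embedding.nonempty_of_card_le (by simpa using hB)
  obtain ⟨j⟩ := hemb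
  -- All vertices outside `B` are merged into one. A vertex of `B` is merged with no other, so its
  -- coordinate survives, and these coordinates detect every vector of the span.
  let π : V → Fin (n + 1) := fun v => if h : v ∈ B then (j ⟨v, h⟩).castSucc else Fin.last n
  have hπ : ∀ b ∈ B, ∀ v, π v = π b → v = b := by
    intro b hb v hv
    simp only [π, hb, dif_pos] at hv
    by_cases hvB : v ∈ B
    · simp only [hvB, dif_pos, Fin.castSucc_inj, j.injective.eq_iff, Subtype.mk.injEq] at hv
      exact hv
    · simp only [hvB, dif_neg, not_false_eq_true] at hv
      exact absurd hv.symm (Fin.castSucc_lt_last _).ne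
  refine ⟨π, ?_⟩
  have hT : (fun i => edgeVec (Prod.map π π (z i))) =
      Finsupp.lmapDomain (ZMod 2) (ZMod 2) π ∘ fun i => edgeVec (z i) := by
    funext i
    simp [edgeVec, Finsupp.mapDomain_add]
  rw [hT]
  refine SameSums.of_injective _ _ fun s hs hs0 => hBS s (hle hs) fun b hb => ?_
  have h1 := DFunLike.congr_fun hs0 (π b)
  rw [Finsupp.lmapDomain_apply, Finsupp.mapDomain, Finsupp.sum_apply, Finsupp.sum] at h1
  rw [Finset.sum_eq_single b] at h1
  · simpa using h1
  · intro v _ hvb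
    rw [Finsupp.single_apply, if_neg fun h => hvb (hπ b hb v h)]
  · intro hbs
    simpa using hbs

theorem exists_perm_map {n k : ℕ} (hk : k ≤ n) {f : Fin k → Fin n} (hf : Function.Injective f) :
    ∃ σ : Equiv.Perm (Fin n), ∀ i, σ (f i) = Fin.castLE hk i := by
  obtain ⟨σ, hσ⟩ := Equiv.Perm.exists_extending_pair f (Fin.castLE hk) hf (Fin.castLE_injective hk)
  exact ⟨σ, fun i => hσ i⟩

/-- Two distinct edges either share one vertex or none; they become 01 and 12 (codes 3 and 6), or 01
and 23 (codes 3 and 12). -/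
theorem exists_perm_edgeCode {n : ℕ} (hn : 4 ≤ n) {p q : Fin n × Fin n} (hp : p.1 ≠ p.2)
    (hq : q.1 ≠ q.2) (hpq : edgeVec p ≠ edgeVec q) :
    ∃ σ : Equiv.Perm (Fin n), edgeCode (Prod.map σ σ p) = 3 ∧
      (edgeCode (Prod.map σ σ q) = 6 ∨ edgeCode (Prod.map σ σ q) = 12) := by
  obtain ⟨a, b⟩ := p
  obtain ⟨c, d⟩ := q
  have h3 : ∀ u v w : Fin n, u ≠ v → u ≠ w → v ≠ w → ∃ σ : Equiv.Perm (Fin n),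
      (σ u : ℕ) = 0 ∧ (σ v : ℕ) = 1 ∧ (σ w : ℕ) = 2 := by
    intro u v w huv huw hvw
    have hf : Function.Injective ![u, v, w] := by
      intro i j
      fin_cases i <;> fin_cases j <;> simp [huv, huw, hvw, huv.symm, huw.symm, hvw.symm]
    obtain ⟨σ, hσ⟩ := exists_perm_map (by omega) hf
    exact ⟨σ, congrArg Fin.val (hσ 0), congrArg Fin.val (hσ 1), congrArg Fin.val (hσ 2)⟩
  simp only at hp hq
  by_cases hca : c = a
  · subst hca
    obtain ⟨σ, h0, h1, h2⟩ := h3 b c d hp.symm (fun h => hpq (h ▸ rfl)) hq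
    exact ⟨σ, by simp [edgeCode, h0, h1], .inl (by simp [edgeCode, h1, h2])⟩
  by_cases hcb : c = b
  · subst hcb
    obtain ⟨σ, h0, h1, h2⟩ := h3 a c d hp (fun h => hpq (h ▸ edgeVec_swap _ _)) hq
    exact ⟨σ, by simp [edgeCode, h0, h1], .inl (by simp [edgeCode, h1, h2])⟩
  by_cases hda : d = a
  · subst hda
    obtain ⟨σ, h0, h1, h2⟩ := h3 b d c hp.symm (fun h => hpq (h ▸ edgeVec_swap _ _)) hq.symm
    exact ⟨σ, by simp [edgeCode, h0, h1], .inl (by simp [edgeCode, h1, h2])⟩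
  by_cases hdb : d = b
  · subst hdb
    obtain ⟨σ, h0, h1, h2⟩ := h3 a d c hp (fun h => hpq (h ▸ rfl)) hq.symm
    exact ⟨σ, by simp [edgeCode, h0, h1], .inl (by simp [edgeCode, h1, h2])⟩
  have hf : Function.Injective ![a, b, c, d] := by
    intro i j
    fin_cases i <;> fin_cases j <;> simp [hp, hq, hca, hcb, hda, hdb, hp.symm, hq.symm,
      Ne.symm hca, Ne.symm hcb, Ne.symm hda, Ne.symm hdb]
  obtain ⟨σ, hσ⟩ := exists_perm_map hn hf
  have h0 : (σ a : ℕ) = 0 := congrArg Fin.val (hσ 0)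
  have h1 : (σ b : ℕ) = 1 := congrArg Fin.val (hσ 1)
  have h2 : (σ c : ℕ) = 2 := congrArg Fin.val (hσ 2)
  have h3 : (σ d : ℕ) = 3 := congrArg Fin.val (hσ 3)
  exact ⟨σ, by simp [edgeCode, h0, h1], .inr (by simp [edgeCode, h2, h3])⟩

theorem sameSums_edgeVec_map {n m : ℕ} (z : ι → Fin n × Fin n) {σ : Fin n → Fin m}
    (hσ : Function.Injective σ) :
    SameSums (fun i => edgeVec (z i)) fun i => edgeVec (Prod.map σ σ (z i)) := by
  have hT : (fun i => edgeVec (Prod.map σ σ (z i))) =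
      Finsupp.lmapDomain (ZMod 2) (ZMod 2) σ ∘ fun i => edgeVec (z i) := by
    funext i
    simp [edgeVec, Finsupp.mapDomain_add]
  rw [hT]
  refine SameSums.of_injective _ _ fun s _ hs => Finsupp.mapDomain_injective hσ ?_
  rw [Finsupp.mapDomain_zero]
  exact hs

theorem IsRep.exists_of_isomorphic {M : Matroid α} {N : Matroid β} [Nonempty β] {w : β → W}
    (hN : IsRep N w) (h : Isomorphic M N) :
    ∃ r : α → β, Set.BijOn r M.E N.E ∧ IsRep M fun e => w (r e) := by
  classical
  obtain ⟨φ, hφ⟩ := h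
  -- The value outside the ground set is immaterial: `IsRep` only concerns subsets of `M.E`.
  refine ⟨fun e => if he : e ∈ M.E then φ ⟨e, he⟩ else Classical.arbitrary _, ⟨?_, ?_, ?_⟩, ?_⟩
  · intro e he
    simp [he]
  · intro e he e' he' h
    simpa [he, he', Subtype.val_inj] using h
  · intro f hf
    exact ⟨φ.symm ⟨f, hf⟩, by simp⟩
  rw [isRep_iff_subtype] at hN ⊢
  intro I
  rw [hφ, hN, linearIndepOn_image_iff φ.injective]
  have : (w ∘ Subtype.val) ∘ φ = (fun e => w (if he : e ∈ M.E then φ ⟨e, he⟩ else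
      Classical.arbitrary _)) ∘ Subtype.val := by
    funext e
    simp
  rw [this]

/-- A graphic matroid is represented by edge vectors. -/
theorem IsGraphic.exists_isRep {M : Matroid α} (hM : IsGraphic M) {x : α} (hx : x ∈ M.E) :
    ∃ (V : Type) (z : α → V × V), IsRep M fun e => edgeVec (z e) := by
  obtain ⟨V, β, G, -, -, hiso⟩ := hM
  obtain ⟨φ, hφ⟩ := id hiso
  obtain ⟨a, b, hab⟩ := G.exists_isLink_of_mem_edgeSet (φ ⟨x, hx⟩).2
  have hV : Nonempty V := ⟨a⟩
  have hβ : Nonempty β := ⟨φ ⟨x, hx⟩⟩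
  obtain ⟨z, hz⟩ := exists_isRep_cycleMatroid G
  obtain ⟨r, -, hr⟩ := hz.exists_of_isomorphic hiso
  exact ⟨V, fun e => z (r e), hr⟩

theorem IsRep.exists_codes {M : Matroid α} {z : α → V × V} (hz : IsRep M fun e => edgeVec (z e))
    {n : ℕ} (hn : 3 ≤ n) {t : Fin n → V →₀ ZMod 2}
    (ht : ∀ e ∈ M.E, edgeVec (z e) ∈ Submodule.span (ZMod 2) (Set.range t)) {x y : α}
    (hx : x ∈ M.E) (hy : y ∈ M.E) (hx0 : edgeVec (z x) ≠ 0) (hy0 : edgeVec (z y) ≠ 0)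
    (hxy : edgeVec (z x) ≠ edgeVec (z y)) :
    ∃ d : α → Fin (n + 1) × Fin (n + 1), (IsRep M fun e => bits (edgeCode (d e))) ∧
      edgeCode (d x) = 3 ∧ (edgeCode (d y) = 6 ∨ edgeCode (d y) = 12) := by
  obtain ⟨π, hπ⟩ := exists_sameSums_fin (fun e : M.E => z e) t fun e => ht e e.2
  have hπ' : IsRep M fun e => edgeVec (Prod.map π π (z e)) := hz.congr hπ
  have h0 : ∀ e ∈ M.E, edgeVec (z e) ≠ 0 → (Prod.map π π (z e)).1 ≠ (Prod.map π π (z e)).2 := by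
    intro e he he0 heq
    apply he0
    rw [← hz.isLoop_iff he, hπ'.isLoop_iff he]
    simp only [edgeVec, heq]
    exact ZModModule.add_self _
  have hne : x ≠ y := fun h => hxy (h ▸ rfl)
  have hnv : ∀ e ∈ M.E, edgeVec (z e) ≠ 0 → edgeVec (Prod.map π π (z e)) ≠ 0 := by
    intro e he he0 h
    exact he0 ((hz.isLoop_iff he).1 ((hπ'.isLoop_iff he).2 h))
  have hpq : edgeVec (Prod.map π π (z x)) ≠ edgeVec (Prod.map π π (z y)) := by
    intro h
    apply hxy
    rw [← hz.isCircuit_pair_iff hx hy hne hx0 hy0,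
      hπ'.isCircuit_pair_iff hx hy hne (hnv x hx hx0) (hnv y hy hy0)]
    exact h
  obtain ⟨σ, h3, h6⟩ := exists_perm_edgeCode (by omega) (h0 x hx hx0) (h0 y hy hy0) hpq
  refine ⟨fun e => Prod.map σ σ (Prod.map π π (z e)), ?_, h3, h6⟩
  have h1 : IsRep M fun e => edgeVec (Prod.map σ σ (Prod.map π π (z e))) :=
    hπ'.congr (sameSums_edgeVec_map (fun e : M.E => Prod.map π π (z e)) σ.injective)
  exact h1.congr (sameSums_bits_edgeCode fun e : M.E => Prod.map σ σ (Prod.map π π (z e)))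

/-- A matroid whose codes are, up to their order, those of a relabeled graph is isomorphic to the
cycle matroid of the graph. -/
theorem IsRep.isomorphic_of_perm {M : Matroid α} {c : α → ℕ} (hc : IsRep M fun e => bits (c e))
    {n m : ℕ} {g : Fin n → α} (hg : Function.Injective g) (hgE : Set.range g = M.E)
    {ends : Fin n → Sym2 (Fin m)} {d : Fin n → Fin m × Fin m}
    (hd : ∀ j, ends j = s((d j).1, (d j).2)) {ρ : Fin m → Fin m} (hρ : Function.Injective ρ)
    (hL : (List.ofFn (c ∘ g)).Perm (List.ofFn fun j => edgeCode (Prod.map ρ ρ (d j)))) :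
    Isomorphic M (cycleMatroid (graphOfEnds ends)) := by
  obtain ⟨τ, hτ⟩ := exists_equiv_of_perm_ofFn hL
  rw [hc.isomorphic_iff (isRep_graphOfEnds hd)]
  let ψ : Fin n ≃ M.E := (Equiv.ofInjective g hg).trans (Equiv.setCongr hgE)
  let κ : Fin n ≃ (cycleMatroid (graphOfEnds ends)).E := (Equiv.Set.univ _).symm
  refine ⟨(ψ.symm.trans τ).trans κ, ?_⟩
  have h1 := ((sameSums_edgeVec_map d hρ).trans (sameSums_bits_edgeCode _)).symm.comp
    (ψ.symm.trans τ).injective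
  convert h1 using 1
  swap
  · rfl
  funext e
  obtain ⟨i, rfl⟩ := ψ.surjective e
  simp only [Function.comp, Equiv.trans_apply, Equiv.symm_apply_apply, ← hτ]
  rfl

end SmallRank
/-! ### Minimal matroids are among the seven -/

section Forward

theorem exists_perm_codes₁₁ : ∀ L ∈ codes₁₁, ∃ ρ : Fin 5 → Fin 5, Function.Injective ρ ∧
    L.Perm (List.ofFn fun j => edgeCode (Prod.map ρ ρ (pairs₁₁ j))) := by
  simp only [codes₁₁, List.forall_mem_cons, List.not_mem_nil, false_implies, implies_true, and_true]
  exact ⟨![1, 0, 2, 3, 4], by decide, by decide⟩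

theorem exists_perm_codes₁₂ : ∀ L ∈ codes₁₂, ∃ ρ : Fin 6 → Fin 6, Function.Injective ρ ∧
    L.Perm (List.ofFn fun j => edgeCode (Prod.map ρ ρ (pairs₁₂ j))) := by
  simp only [codes₁₂, List.forall_mem_cons, List.not_mem_nil, false_implies, implies_true, and_true]
  exact ⟨⟨![4, 5, 0, 2, 1, 3], by decide, by decide⟩,
    ⟨![3, 5, 0, 2, 1, 4], by decide, by decide⟩,
    ⟨![3, 4, 0, 2, 1, 5], by decide, by decide⟩,
    ⟨![3, 4, 2, 0, 1, 5], by decide, by decide⟩,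
    ⟨![3, 5, 2, 0, 1, 4], by decide, by decide⟩,
    ⟨![4, 5, 2, 0, 1, 3], by decide, by decide⟩⟩

theorem exists_perm_codes₁₃ : ∀ L ∈ codes₁₃, ∃ ρ : Fin 6 → Fin 6, Function.Injective ρ ∧
    L.Perm (List.ofFn fun j => edgeCode (Prod.map ρ ρ (pairs₁₃ j))) := by
  simp only [codes₁₃, List.forall_mem_cons, List.not_mem_nil, false_implies, implies_true, and_true]
  exact ⟨⟨![4, 5, 1, 3, 2, 0], by decide, by decide⟩,
    ⟨![4, 5, 0, 3, 2, 1], by decide, by decide⟩,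
    ⟨![4, 5, 1, 2, 3, 0], by decide, by decide⟩,
    ⟨![4, 5, 0, 2, 3, 1], by decide, by decide⟩,
    ⟨![4, 5, 3, 1, 0, 2], by decide, by decide⟩,
    ⟨![4, 5, 2, 1, 0, 3], by decide, by decide⟩,
    ⟨![4, 5, 3, 0, 1, 2], by decide, by decide⟩,
    ⟨![4, 5, 2, 0, 1, 3], by decide, by decide⟩⟩

theorem exists_perm_codes₁₄ : ∀ L ∈ codes₁₄, ∃ ρ : Fin 6 → Fin 6, Function.Injective ρ ∧
    L.Perm (List.ofFn fun j => edgeCode (Prod.map ρ ρ (pairs₁₄ j))) := by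
  simp only [codes₁₄, List.forall_mem_cons, List.not_mem_nil, false_implies, implies_true, and_true]
  exact ⟨⟨![2, 3, 4, 5, 1, 0], by decide, by decide⟩,
    ⟨![2, 3, 4, 5, 0, 1], by decide, by decide⟩,
    ⟨![0, 1, 4, 5, 3, 2], by decide, by decide⟩,
    ⟨![0, 1, 4, 5, 2, 3], by decide, by decide⟩⟩

theorem exists_perm_codes₁₅ : ∀ L ∈ codes₁₅, ∃ ρ : Fin 6 → Fin 6, Function.Injective ρ ∧
    L.Perm (List.ofFn fun j => edgeCode (Prod.map ρ ρ (pairs₁₅ j))) := by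
  simp only [codes₁₅, List.forall_mem_cons, List.not_mem_nil, false_implies, implies_true, and_true]
  exact ⟨⟨![0, 1, 4, 5, 3, 2], by decide, by decide⟩,
    ⟨![0, 1, 4, 5, 2, 3], by decide, by decide⟩,
    ⟨![2, 3, 4, 5, 1, 0], by decide, by decide⟩,
    ⟨![2, 3, 4, 5, 0, 1], by decide, by decide⟩⟩

theorem exists_perm_codes₁₆ : ∀ L ∈ codes₁₆, ∃ ρ : Fin 5 → Fin 5, Function.Injective ρ ∧
    L.Perm (List.ofFn fun j => edgeCode (Prod.map ρ ρ (pairs₁₆ j))) := by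
  simp only [codes₁₆, List.forall_mem_cons, List.not_mem_nil, false_implies, implies_true, and_true]
  exact ⟨![1, 2, 0, 3, 4], by decide, by decide⟩

theorem exists_perm_codes₁₇ : ∀ L ∈ codes₁₇, ∃ ρ : Fin 6 → Fin 6, Function.Injective ρ ∧
    L.Perm (List.ofFn fun j => edgeCode (Prod.map ρ ρ (pairs₁₇ j))) := by
  simp only [codes₁₇, List.forall_mem_cons, List.not_mem_nil, false_implies, implies_true, and_true]
  exact ⟨⟨![0, 1, 3, 4, 5, 2], by decide, by decide⟩,
    ⟨![2, 3, 1, 4, 5, 0], by decide, by decide⟩,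
    ⟨![2, 3, 0, 4, 5, 1], by decide, by decide⟩,
    ⟨![0, 1, 2, 4, 5, 3], by decide, by decide⟩⟩

theorem exists_perm_of_isGood {goods : List (List ℕ)} {L : List ℕ} (h : isGood goods L = true) :
    ∃ L' ∈ goods, L.Perm L' :=
  ⟨sortNat L, by simpa [isGood] using h, (sortNat_perm L).symm⟩

/-! ### Rank and degree bounds, and reading off the graph. -/

variable {α V W : Type*} [AddCommGroup W] [Module (ZMod 2) W] {M : Matroid α} {v : α → W}
  {c : α → ℕ} {x y : α}

/-- A circuit through `x` that avoids `y` expresses `v x` by elements other than `x` and `y`. -/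
theorem IsRep.mem_of_forall_ne (hv : IsRep M v) (hs : ∀ x y, x ≠ y → ¬ M.IsCocircuit {x, y})
    (hx : x ∈ M.E) (hxc : ¬ M.IsColoop x) (hxy : x ≠ y) {P : Submodule (ZMod 2) W}
    (hP : ∀ e ∈ M.E, e ≠ x → e ≠ y → v e ∈ P) : v x ∈ P := by
  classical
  obtain ⟨C, hC, hxC, hyC⟩ := exists_isCircuit_of_not_isCocircuit_pair hx hxy hxc (hs x y hxy)
  obtain ⟨D, rfl, hD⟩ := hv.sum_eq_zero_of_isCircuit hC
  rw [← Finset.add_sum_erase _ _ (show x ∈ D from hxC), add_eq_zero_iff_eq_neg,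
    ZModModule.neg_eq_self] at hD
  rw [hD]
  refine Submodule.sum_mem _ fun e he => hP e (hC.subset_ground (Finset.mem_of_mem_erase he))
    (Finset.ne_of_mem_erase he) ?_
  rintro rfl
  exact hyC (Finset.mem_of_mem_erase he)

theorem IsRep.forall_mem (hv : IsRep M v) (hs : ∀ x y, x ≠ y → ¬ M.IsCocircuit {x, y})
    (hx : x ∈ M.E) (hxc : ¬ M.IsColoop x) (hxy : x ≠ y) {P : Submodule (ZMod 2) W}
    (hP : ∀ e ∈ M.E, e ≠ x → e ≠ y → v e ∈ P) (hxyP : v x + v y ∈ P) : ∀ e ∈ M.E, v e ∈ P := by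
  have h1 := hv.mem_of_forall_ne hs hx hxc hxy hP
  intro e he
  by_cases hex : e = x
  · rwa [hex]
  by_cases hey : e = y
  · rw [hey]
    exact (Submodule.add_mem_iff_right _ h1).1 hxyP
  · exact hP e he hex hey

theorem mem_of_triangles {h : Fin 10 → W} {P : Submodule (ZMod 2) W} (h0 : h 0 ∈ P) (h1 : h 1 ∈ P)
    (h3 : h 3 ∈ P) (h6 : h 6 ∈ P) (t1 : h 0 + h 1 + h 2 ∈ P) (t2 : h 0 + h 3 + h 4 ∈ P)
    (t3 : h 1 + h 3 + h 5 ∈ P) (t4 : h 0 + h 6 + h 7 ∈ P) (t5 : h 1 + h 6 + h 8 ∈ P)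
    (t6 : h 3 + h 6 + h 9 ∈ P) : ∀ i, h i ∈ P := by
  have key : ∀ {a b c : W}, a ∈ P → b ∈ P → a + b + c ∈ P → c ∈ P := fun ha hb h =>
    (Submodule.add_mem_iff_right _ (Submodule.add_mem _ ha hb)).1 h
  intro i
  fin_cases i
  · exact h0
  · exact h1
  · exact key h0 h1 t1
  · exact h3
  · exact key h0 h3 t2
  · exact key h1 h3 t3
  · exact h6
  · exact key h0 h6 t4
  · exact key h1 h6 t5
  · exact key h3 h6 t6

/-- The rank bound when one vector of the configuration is the sum of those of `x` and `y`. -/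
theorem IsRep.exists_span_four [DecidableEq α] (hv : IsRep M v)
    (hs : ∀ x y, x ≠ y → ¬ M.IsCocircuit {x, y}) (hx : x ∈ M.E) (hy : y ∈ M.E)
    (hxc : ¬ M.IsColoop x) (hxy : x ≠ y) {g : Fin 10 → α} (hgE : M.E \ {x} ⊆ Set.range g)
    (hg : IsK5Config fun i => Function.update v y (v x + v y) (g i)) :
    ∃ t : Fin 4 → W, ∀ e ∈ M.E, v e ∈ Submodule.span (ZMod 2) (Set.range t) := by
  let h : Fin 10 → W := fun i => Function.update v y (v x + v y) (g i)
  let t : Fin 4 → W := ![h 0, h 1, h 3, h 6]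
  have ht : ∀ i, t i ∈ Submodule.span (ZMod 2) (Set.range t) := fun i =>
    Submodule.subset_span ⟨i, rfl⟩
  have hP : ∀ i, h i ∈ Submodule.span (ZMod 2) (Set.range t) := by
    refine mem_of_triangles (ht 0) (ht 1) (ht 2) (ht 3) ?_ ?_ ?_ ?_ ?_ ?_
    · exact hg.3 ▸ Submodule.zero_mem _
    · exact hg.4 ▸ Submodule.zero_mem _
    · exact hg.5 ▸ Submodule.zero_mem _
    · exact hg.6 ▸ Submodule.zero_mem _
    · exact hg.7 ▸ Submodule.zero_mem _
    · exact hg.8 ▸ Submodule.zero_mem _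
  refine ⟨t, hv.forall_mem hs hx hxc hxy (fun e he hex hey => ?_) ?_⟩
  · obtain ⟨i, rfl⟩ := hgE ⟨he, hex⟩
    simpa [h, hey] using hP i
  · obtain ⟨i, rfl⟩ := hgE ⟨hy, hxy.symm⟩
    simpa [h] using hP i

/-- The rank bound when the configuration is in the quotient by the sum of `x` and `y`. -/
theorem IsRep.exists_span_five (hv : IsRep M v)
    (hs : ∀ x y, x ≠ y → ¬ M.IsCocircuit {x, y}) (hx : x ∈ M.E)
    (hxc : ¬ M.IsColoop x) (hxy : x ≠ y) {g : Fin 10 → α} (hgE : M.E \ {x, y} ⊆ Set.range g)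
    (hg : IsK5Config fun i => quotLine (v x + v y) (v (g i))) :
    ∃ t : Fin 5 → W, ∀ e ∈ M.E, v e ∈ Submodule.span (ZMod 2) (Set.range t) := by
  let t : Fin 5 → W := ![v (g 0), v (g 1), v (g 3), v (g 6), v x + v y]
  have ht : ∀ i, t i ∈ Submodule.span (ZMod 2) (Set.range t) := fun i =>
    Submodule.subset_span ⟨i, rfl⟩
  have hq : ∀ a b c : W, quotLine (v x + v y) a + quotLine (v x + v y) b +
      quotLine (v x + v y) c = 0 → a + b + c ∈ Submodule.span (ZMod 2) (Set.range t) := by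
    intro a b c h
    rw [← map_add, ← map_add, Submodule.mkQ_apply, Submodule.Quotient.mk_eq_zero] at h
    refine Submodule.span_mono ?_ h
    rintro _ rfl
    exact ⟨4, rfl⟩
  have hP : ∀ i, v (g i) ∈ Submodule.span (ZMod 2) (Set.range t) :=
    mem_of_triangles (h := fun i => v (g i)) (ht 0) (ht 1) (ht 2) (ht 3) (hq _ _ _ hg.3)
      (hq _ _ _ hg.4) (hq _ _ _ hg.5) (hq _ _ _ hg.6) (hq _ _ _ hg.7) (hq _ _ _ hg.8)
  refine ⟨t, hv.forall_mem hs hx hxc hxy (fun e he hex hey => ?_) (ht 4)⟩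
  obtain ⟨i, rfl⟩ := hgE ⟨he, by simp [hex, hey]⟩
  exact hP i

/-- The `i`th binary digit is the functional of the star of vertex `i`, so this bounds the degree of
an end of `x`. -/
theorem IsRep.three_le_countP (hc : IsRep M fun e => bits (c e))
    (hs : ∀ x y, x ≠ y → ¬ M.IsCocircuit {x, y}) (hx : x ∈ M.E) (hxc : ¬ M.IsColoop x) {n : ℕ}
    {g : Fin n → α} (hgE : Set.range g = M.E) {i : ℕ} (hi : (c x).testBit i = true) :
    3 ≤ (List.ofFn (c ∘ g)).countP fun a => a.testBit i := by
  have hf : ∀ e, (LinearMap.proj i : (ℕ → ZMod 2) →ₗ[ZMod 2] ZMod 2) (bits (c e)) ≠ 0 ↔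
      (c e).testBit i = true := by
    intro e
    simp [bits]
  obtain ⟨p, hp, q, hq, hpx, hqx, hpq, hp1, hq1⟩ :=
    hc.three_le_card hs hx hxc (LinearMap.proj i) ((hf x).2 hi)
  rw [hf] at hp1 hq1
  rw [← hgE] at hx hp hq
  obtain ⟨j, rfl⟩ := hx
  obtain ⟨k, rfl⟩ := hp
  obtain ⟨l, rfl⟩ := hq
  exact three_le_countP_ofFn (i := j) (j := k) (k := l) (fun h => hpx (h ▸ rfl))
    (fun h => hqx (h ▸ rfl)) (fun h => hpq (h ▸ rfl)) hi hp1 hq1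

theorem edgeCode_mem_codes5 : ∀ z : Fin 5 × Fin 5, edgeCode z ≠ 0 → edgeCode z ∈ codes5 := by
  decide

theorem edgeCode_mem_codes6 : ∀ z : Fin 6 × Fin 6, edgeCode z ≠ 0 → edgeCode z ∈ codes6 := by
  decide

theorem ofFn_cons {n : ℕ} (a : α) (g : Fin n → α) :
    List.ofFn (c ∘ (Fin.cons a g : Fin (n + 1) → α)) = c a :: List.ofFn (c ∘ g) := by
  rw [List.ofFn_succ]
  rfl

theorem cons_injective_range {n : ℕ} {a : α} {g : Fin n → α} (hg : Function.Injective g)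
    (ha : a ∉ Set.range g) : Function.Injective (Fin.cons a g : Fin (n + 1) → α) ∧
      Set.range (Fin.cons a g : Fin (n + 1) → α) = insert a (Set.range g) :=
  ⟨Fin.cons_injective_iff.2 ⟨ha, hg⟩, Fin.range_cons _ _⟩

open Classical in
/-- The outcome of the search among the twisted configurations. -/
theorem exists_twistLeaf {d : α → Fin 5 × Fin 5} (hd : ∀ e, c e = edgeCode (d e)) (hcx : c x = 3)
    (hcy : c y = 6 ∨ c y = 12) {g : Fin 10 → α} (hg : Function.Injective g)
    (hyg : y ∈ Set.range g)
    (h : IsK5Config fun i =>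
      Function.update (fun e => bits (c e)) y (bits (c x) + bits (c y)) (g i)) :
    ∃ g' : Fin 10 → α, Function.Injective g' ∧ Set.range g' = Set.range g ∧
      isGood codes₁₁ (3 :: List.ofFn (c ∘ g')) = true ∧
      (3 ∈ List.ofFn (c ∘ g') → isGood codes₁₆ (List.ofFn (c ∘ g')) = true) := by
  let k : α → ℕ := Function.update c y (3 ^^^ c y)
  have hk : (fun i => Function.update (fun e => bits (c e)) y (bits (c x) + bits (c y)) (g i)) =
      fun i => bits (k (g i)) := by
    funext i
    by_cases hi : g i = y
    · simp [k, hi, bits_xor, hcx]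
    · simp [k, hi]
  rw [hk, isK5Config_bits_iff] at h
  obtain ⟨τ, hτ, h01, h13, h36⟩ := h.exists_sorted (by simp)
  have hg' : Function.Injective (g ∘ τ) := hg.comp τ.injective
  have hrange : Set.range (g ∘ τ) = Set.range g := τ.surjective.range_comp g
  rw [← hrange] at hyg
  obtain ⟨i₀, hi₀⟩ := hyg
  have hki₀ : ∀ i, i = i₀ → k (g (τ i)) = 3 ^^^ c y := by
    rintro i rfl
    have : g (τ i) = y := hi₀
    simp [k, this]
  have hki : ∀ i, i ≠ i₀ → k (g (τ i)) = c (g (τ i)) := by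
    intro i hi
    have : g (τ i) ≠ y := fun h => hi (hg' (h.trans hi₀.symm))
    simp [k, this]
  have hmem : ∀ i, i ≠ i₀ → k (g (τ i)) ∈ codes5 := by
    intro i hi
    have h0 : k (g (τ i)) ≠ 0 := by simpa using hτ.notMem i
    rw [hki i hi, hd] at h0 ⊢
    exact edgeCode_mem_codes5 _ h0
  -- Moving `y` back to its own code recovers the codes in `M`.
  have hset : (List.ofFn fun i => k (g (τ i))).set i₀ (c y) = List.ofFn (c ∘ g ∘ τ) := by
    refine List.ext_getElem (by simp) fun n h1 h2 => ?_
    rw [List.getElem_set]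
    have hn : n < 10 := by simpa using h2
    split_ifs with hi
    · have : (⟨n, hn⟩ : Fin 10) = i₀ := Fin.ext hi.symm
      simp only [List.getElem_ofFn, Function.comp, this]
      exact congrArg c hi₀.symm
    · have : (⟨n, hn⟩ : Fin 10) ≠ i₀ := fun h => hi (by rw [← h])
      simp only [List.getElem_ofFn, Function.comp]
      exact hki _ this
  have hok : ∀ i : Fin 10, twistOK (3 ^^^ c y) i₀ i (k (g (τ i))) = true := by
    intro i
    by_cases hi : i = i₀
    · simp [twistOK, hi, hki₀ i₀ rfl]
    · have : (i : ℕ) ≠ i₀ := fun h => hi (Fin.ext h)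
      simp [twistOK, this, elem_iff, hmem i hi]
  refine ⟨g ∘ τ, hg', hrange, ?_⟩
  obtain hcy | hcy := hcy
  · have hl := leaf_eq_true_of_search (search_twist_six i₀ i₀.2) hτ (fun i => ?_)
      (by simpa [hcy] using hok) h01 h13 h36
    · change twistLeaf 6 i₀ codes₁₁ codes₁₆ (List.ofFn fun i => k (g (τ i))) = true at hl
      rw [hcy] at hset
      simp only [twistLeaf, hset, Bool.and_eq_true] at hl
      refine ⟨hl.1, fun h3 => ?_⟩
      have := hl.2
      rwa [elem_iff.2 h3] at this
    · by_cases hi : i = i₀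
      · change k (g (τ i)) ∈ _
        rw [hki₀ i hi, hcy]
        decide
      · exact hmem i hi
  -- With `x` and `y` disjoint the list of admissible outcomes is empty, so this case is
  -- contradictory.
  · have hl := leaf_eq_true_of_search (search_twist_twelve i₀ i₀.2) hτ (fun i => ?_)
      (by simpa [hcy] using hok) h01 h13 h36
    · simp [twistLeaf, isGood] at hl
    · by_cases hi : i = i₀
      · change k (g (τ i)) ∈ _
        rw [hki₀ i hi, hcy]
        decide
      · exact List.mem_cons_of_mem _ (hmem i hi)

/-- The outcome of the search among the configurations in the quotient. -/
theorem exists_quotLeaf {d : α → Fin 6 × Fin 6} (hd : ∀ e, c e = edgeCode (d e)) (hcx : c x = 3)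
    {g : Fin 10 → α} (hg : Function.Injective g)
    (h : IsK5Config fun i => quotLine (bits (c x) + bits (c y)) (bits (c (g i)))) :
    ∃ g' : Fin 10 → α, Function.Injective g' ∧ Set.range g' = Set.range g ∧
      (c y = 6 → quotLeaf 6 [0, 1, 2] codes₁₂ [] (List.ofFn (c ∘ g')) = true) ∧
      (c y = 12 → quotLeaf 12 [0, 1, 2, 3] (codes₁₃ ++ codes₁₄ ++ codes₁₅) codes₁₇
        (List.ofFn (c ∘ g')) = true) := by
  rw [← bits_xor, isK5Config_quotLine_iff, hcx] at h
  obtain ⟨τ, hτ, h01, h13, h36⟩ := h.exists_sorted (by simp)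
  have hmem : ∀ i, c (g (τ i)) ∈ codes6 := by
    intro i
    have h0 : c (g (τ i)) ≠ 0 := fun h0 => hτ.notMem i (by simp [h0])
    rw [hd] at h0 ⊢
    exact edgeCode_mem_codes6 _ h0
  refine ⟨g ∘ τ, hg.comp τ.injective, τ.surjective.range_comp g, fun hy => ?_, fun hy => ?_⟩
  · rw [hy] at hτ
    exact leaf_eq_true_of_search search_quot_six hτ hmem (fun i => elem_iff.2 (hmem i)) h01 h13 h36
  · rw [hy] at hτ
    exact leaf_eq_true_of_search search_quot_twelve hτ hmem (fun i => elem_iff.2 (hmem i)) h01 h13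
      h36

open Classical in
theorem IsRep.isomorphic_of_twist {z : α → V × V} (hz : IsRep M fun e => edgeVec (z e))
    (hs : ∀ x y, x ≠ y → ¬ M.IsCocircuit {x, y}) (hx : x ∈ M.E) (hy : y ∈ M.E)
    (hxc : ¬ M.IsColoop x) (hx0 : edgeVec (z x) ≠ 0) (hy0 : edgeVec (z y) ≠ 0)
    (hxy : edgeVec (z x) ≠ edgeVec (z y)) {M' : Matroid (α ⊕ Unit)}
    (hM' : IsElementSplitting M {x, y} M') :
    (Isomorphic (M' ＼ {Sum.inr ()} ／ {Sum.inl x}) (cycleMatroid K5) →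
      Isomorphic M (cycleMatroid G11)) ∧
    (Isomorphic (M' ／ {Sum.inl x}) (cycleMatroid K5) → Isomorphic M (cycleMatroid G16)) := by
  have hne : x ≠ y := fun h => hxy (h ▸ rfl)
  have key : ∀ t : Fin 4 → V →₀ ZMod 2,
      (∀ e ∈ M.E, edgeVec (z e) ∈ Submodule.span (ZMod 2) (Set.range t)) →
      ∃ c : α → ℕ, ∃ d : α → Fin 5 × Fin 5, (∀ e, c e = edgeCode (d e)) ∧
        (IsRep M fun e => bits (c e)) ∧ c x = 3 ∧ (c y = 6 ∨ c y = 12) ∧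
          bits (c x) ≠ bits (c y) := by
    intro t ht
    obtain ⟨d, hd, h3, h6⟩ := hz.exists_codes (by norm_num) ht hx hy hx0 hy0 hxy
    refine ⟨fun e => edgeCode (d e), d, fun _ => rfl, hd, h3, h6, fun h => ?_⟩
    have := bits_injective h
    simp only [h3] at this
    omega
  constructor
  · intro hiso
    obtain ⟨g, hg, hgE, hc⟩ := (hM'.delete_contract_iff hz hx hxy).1 hiso
    obtain ⟨t, ht⟩ := hz.exists_span_four hs hx hy hxc hne hgE.ge hc
    obtain ⟨c, d, hd, hcr, hcx, hcy, hcxy⟩ := key t ht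
    -- The criterion is applied a second time: the first application, to the original edge vectors,
    -- only served to bound the rank; this one gives a configuration of codes on five vertices.
    obtain ⟨g, hg, hgE, hc⟩ := (hM'.delete_contract_iff hcr hx hcxy).1 hiso
    obtain ⟨g', hg', hgE', hgood, -⟩ := exists_twistLeaf hd hcx hcy hg
      (by rw [hgE]; exact ⟨hy, hne.symm⟩) hc
    obtain ⟨L, hL, hperm⟩ := exists_perm_of_isGood hgood
    obtain ⟨ρ, hρ, hperm'⟩ := exists_perm_codes₁₁ L hL
    obtain ⟨hi, hr⟩ := cons_injective_range hg' (a := x) (by simp [hgE', hgE])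
    refine hcr.isomorphic_of_perm hi (by rw [hr, hgE', hgE]; simp [hx])
      (d := pairs₁₁) (by decide) hρ ?_
    rw [ofFn_cons, hcx]
    exact hperm.trans hperm'
  · intro hiso
    obtain ⟨g, hg, hgE, hc⟩ := (hM'.contract_iff hz hx hxy).1 hiso
    obtain ⟨t, ht⟩ := hz.exists_span_four hs hx hy hxc hne (hgE ▸ Set.sdiff_subset) hc
    obtain ⟨c, d, hd, hcr, hcx, hcy, hcxy⟩ := key t ht
    obtain ⟨g, hg, hgE, hc⟩ := (hM'.contract_iff hcr hx hcxy).1 hiso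
    obtain ⟨g', hg', hgE', -, hgood⟩ := exists_twistLeaf hd hcx hcy hg (by rw [hgE]; exact hy) hc
    rw [← hgE, ← hgE'] at hx
    obtain ⟨i, hi⟩ := hx
    obtain ⟨L, hL, hperm⟩ := exists_perm_of_isGood
      (hgood (List.mem_ofFn.2 ⟨i, by rw [← hcx, ← hi]; rfl⟩))
    obtain ⟨ρ, hρ, hperm'⟩ := exists_perm_codes₁₆ L hL
    exact hcr.isomorphic_of_perm hg' (hgE'.trans hgE) (d := pairs₁₆) (by decide) hρ
      (hperm.trans hperm')

theorem IsRep.isomorphic_of_quot {z : α → V × V} (hz : IsRep M fun e => edgeVec (z e))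
    (hs : ∀ x y, x ≠ y → ¬ M.IsCocircuit {x, y}) (hx : x ∈ M.E) (hy : y ∈ M.E)
    (hxc : ¬ M.IsColoop x) (hyc : ¬ M.IsColoop y) (hx0 : edgeVec (z x) ≠ 0)
    (hy0 : edgeVec (z y) ≠ 0)
    (hxy : edgeVec (z x) ≠ edgeVec (z y)) {M' : Matroid (α ⊕ Unit)}
    (hM' : IsElementSplitting M {x, y} M') :
    (Isomorphic (M' ＼ {Sum.inr ()} ／ {Sum.inl x, Sum.inl y}) (cycleMatroid K5) →
      Isomorphic M (cycleMatroid G12) ∨ Isomorphic M (cycleMatroid G13) ∨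
      Isomorphic M (cycleMatroid G14) ∨ Isomorphic M (cycleMatroid G15)) ∧
    (Isomorphic (M' ／ {Sum.inl x, Sum.inl y}) (cycleMatroid K5) →
      Isomorphic M (cycleMatroid G17)) := by
  have hne : x ≠ y := fun h => hxy (h ▸ rfl)
  have key : ∀ t : Fin 5 → V →₀ ZMod 2,
      (∀ e ∈ M.E, edgeVec (z e) ∈ Submodule.span (ZMod 2) (Set.range t)) →
      ∃ c : α → ℕ, ∃ d : α → Fin 6 × Fin 6, (∀ e, c e = edgeCode (d e)) ∧
        (IsRep M fun e => bits (c e)) ∧ c x = 3 ∧ (c y = 6 ∨ c y = 12) ∧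
          bits (c x) ≠ bits (c y) := by
    intro t ht
    obtain ⟨d, hd, h3, h6⟩ := hz.exists_codes (by norm_num) ht hx hy hx0 hy0 hxy
    refine ⟨fun e => edgeCode (d e), d, fun _ => rfl, hd, h3, h6, fun h => ?_⟩
    have := bits_injective h
    simp only [h3] at this
    omega
  -- Vertices 0 and 1 are the ends of `x`; the other listed vertices are ends of `y`.
  have hdeg : ∀ c : α → ℕ, (IsRep M fun e => bits (c e)) → c x = 3 → ∀ n, ∀ g : Fin n → α,
      Set.range g = M.E → (c y = 6 → degreeOK [0, 1, 2] (List.ofFn (c ∘ g)) = true) ∧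
        (c y = 12 → degreeOK [0, 1, 2, 3] (List.ofFn (c ∘ g)) = true) := by
    intro c hcr hcx n g hgE
    have h1 : ∀ i, (3).testBit i = true → 3 ≤ (List.ofFn (c ∘ g)).countP fun a => a.testBit i :=
      fun i hi => hcr.three_le_countP hs hx hxc hgE (by rwa [hcx])
    have h2 : ∀ i, (c y).testBit i = true →
        3 ≤ (List.ofFn (c ∘ g)).countP fun a => a.testBit i :=
      fun i hi => hcr.three_le_countP hs hy hyc hgE hi
    constructor
    · intro hy
      rw [hy] at h2
      simp only [degreeOK, List.all_cons, List.all_nil, Bool.and_eq_true, Nat.ble_eq, and_true]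
      exact ⟨h1 0 (by decide), h1 1 (by decide), h2 2 (by decide)⟩
    · intro hy
      rw [hy] at h2
      simp only [degreeOK, List.all_cons, List.all_nil, Bool.and_eq_true, Nat.ble_eq, and_true]
      exact ⟨h1 0 (by decide), h1 1 (by decide), h2 2 (by decide), h2 3 (by decide)⟩
  constructor
  · intro hiso
    obtain ⟨g, hg, hgE, hc⟩ := (hM'.delete_contract_pair_iff hz hx hy hxy).1 hiso
    obtain ⟨t, ht⟩ := hz.exists_span_five hs hx hxc hne hgE.ge hc
    obtain ⟨c, d, hd, hcr, hcx, hcy, hcxy⟩ := key t ht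
    obtain ⟨g, hg, hgE, hc⟩ := (hM'.delete_contract_pair_iff hcr hx hy hcxy).1 hiso
    obtain ⟨g', hg', hgE', h6, h12⟩ := exists_quotLeaf hd hcx hg hc
    obtain ⟨hi₁, hr₁⟩ := cons_injective_range hg' (a := y) (by simp [hgE', hgE])
    obtain ⟨hi, hr⟩ := cons_injective_range hi₁ (a := x) (by simp [hr₁, hgE', hgE, hne])
    have hE : Set.range (Fin.cons x (Fin.cons y g' : Fin 11 → α) : Fin 12 → α) = M.E := by
      rw [hr, hr₁, hgE', hgE]
      ext e
      by_cases hex : e = x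
      · simp [hex, hx]
      · by_cases hey : e = y
        · simp [hey, hy]
        · simp [hex, hey]
    have hofFn : List.ofFn (c ∘ (Fin.cons x (Fin.cons y g' : Fin 11 → α) : Fin 12 → α)) =
        3 :: c y :: List.ofFn (c ∘ g') := by
      rw [ofFn_cons, ofFn_cons, hcx]
    obtain ⟨hd6, hd12⟩ := hdeg c hcr hcx _ _ hE
    rw [hofFn] at hd6 hd12
    obtain hcy | hcy := hcy
    · have h := h6 hcy
      rw [hcy] at hd6 hofFn
      simp only [quotLeaf, hd6 rfl, cond_true, Bool.and_eq_true] at h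
      obtain ⟨L, hL, hperm⟩ := exists_perm_of_isGood h.1
      obtain ⟨ρ, hρ, hperm'⟩ := exists_perm_codes₁₂ L hL
      exact .inl (hcr.isomorphic_of_perm hi hE (d := pairs₁₂) (by decide) hρ
        (hofFn ▸ hperm.trans hperm'))
    · have h := h12 hcy
      rw [hcy] at hd12 hofFn
      simp only [quotLeaf, hd12 rfl, cond_true, Bool.and_eq_true] at h
      obtain ⟨L, hL, hperm⟩ := exists_perm_of_isGood h.1
      rw [List.mem_append, List.mem_append] at hL
      obtain (hL | hL) | hL := hL
      · obtain ⟨ρ, hρ, hperm'⟩ := exists_perm_codes₁₃ L hL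
        exact .inr (.inl (hcr.isomorphic_of_perm hi hE (d := pairs₁₃) (by decide) hρ
          (hofFn ▸ hperm.trans hperm')))
      · obtain ⟨ρ, hρ, hperm'⟩ := exists_perm_codes₁₄ L hL
        exact .inr (.inr (.inl (hcr.isomorphic_of_perm hi hE (d := pairs₁₄) (by decide) hρ
          (hofFn ▸ hperm.trans hperm'))))
      · obtain ⟨ρ, hρ, hperm'⟩ := exists_perm_codes₁₅ L hL
        exact .inr (.inr (.inr (hcr.isomorphic_of_perm hi hE (d := pairs₁₅) (by decide) hρ
          (hofFn ▸ hperm.trans hperm'))))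
  · intro hiso
    obtain ⟨g, hg, hgE, hc⟩ := (hM'.contract_pair_iff hz hx hy hxy).1 hiso
    obtain ⟨t, ht⟩ := hz.exists_span_five hs hx hxc hne
      (hgE ▸ Set.sdiff_subset_sdiff_right (by simp)) hc
    obtain ⟨c, d, hd, hcr, hcx, hcy, hcxy⟩ := key t ht
    obtain ⟨g, hg, hgE, hc⟩ := (hM'.contract_pair_iff hcr hx hy hcxy).1 hiso
    obtain ⟨g', hg', hgE', h6, h12⟩ := exists_quotLeaf hd hcx hg hc
    obtain ⟨hi, hr⟩ := cons_injective_range hg' (a := y) (by simp [hgE', hgE])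
    have hE : Set.range (Fin.cons y g' : Fin 11 → α) = M.E := by
      rw [hr, hgE', hgE]
      simp [hy]
    have hofFn := ofFn_cons (c := c) y g'
    obtain ⟨hd6, hd12⟩ := hdeg c hcr hcx _ _ hE
    rw [hofFn] at hd6 hd12
    have hxg : x ∈ Set.range g' := by
      rw [hgE', hgE]
      exact ⟨hx, hne⟩
    obtain ⟨i, hix⟩ := hxg
    have hel : elem (List.ofFn (c ∘ g')) 3 = true :=
      elem_iff.2 (List.mem_ofFn.2 ⟨i, by rw [← hcx, ← hix]; rfl⟩)
    obtain hcy | hcy := hcy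
    · have h := h6 hcy
      rw [hcy] at hd6
      simp only [quotLeaf, hd6 rfl, hel, Bool.and_self, cond_true, Bool.and_eq_true] at h
      obtain ⟨L, hL, -⟩ := exists_perm_of_isGood h.2
      simp at hL
    · have h := h12 hcy
      rw [hcy] at hd12 hofFn
      simp only [quotLeaf, hd12 rfl, hel, Bool.and_self, cond_true, Bool.and_eq_true] at h
      obtain ⟨L, hL, hperm⟩ := exists_perm_of_isGood h.2
      obtain ⟨ρ, hρ, hperm'⟩ := exists_perm_codes₁₇ L hL
      exact hcr.isomorphic_of_perm hi hE (d := pairs₁₇) (by decide) hρ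
        (hofFn ▸ hperm.trans hperm')

theorem IsMinimal.isomorphic (hM : IsGraphic M) (h : IsMinimal M (cycleMatroid K5)) :
    Isomorphic M (cycleMatroid G11) ∨ Isomorphic M (cycleMatroid G12) ∨
      Isomorphic M (cycleMatroid G13) ∨ Isomorphic M (cycleMatroid G14) ∨
      Isomorphic M (cycleMatroid G15) ∨ Isomorphic M (cycleMatroid G16) ∨
      Isomorphic M (cycleMatroid G17) := by
  obtain ⟨hs, x, hx, y, hy, hne, hxl, hyl, hxc, hyc, hcirc, M', hM', hor⟩ := h
  obtain ⟨V, z, hz⟩ := hM.exists_isRep hx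
  rw [hz.isLoop_iff hx] at hxl
  rw [hz.isLoop_iff hy] at hyl
  rw [hz.isCircuit_pair_iff hx hy hne hxl hyl] at hcirc
  obtain ⟨h1, h4⟩ := hz.isomorphic_of_twist hs hx hy hxc hxl hyl hcirc hM'
  obtain ⟨h2, h5⟩ := hz.isomorphic_of_quot hs hx hy hxc hyc hxl hyl hcirc hM'
  have h3 := hM'.not_isomorphic_K5 hz hx hy hcirc
  obtain h | h | h | h | h := hor
  · exact .inl (h1 h)
  · obtain h | h | h | h := h2 h <;> simp only [h, true_or, or_true]
  · exact absurd h h3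
  · exact .inr (.inr (.inr (.inr (.inr (.inl (h4 h))))))
  · exact .inr (.inr (.inr (.inr (.inr (.inr (h5 h))))))

end Forward
/-! ### The seven matroids are minimal -/

section Backward

variable {α : Type*} {M : Matroid α} {c : α → ℕ}

/-- The lists in `Cs` are cycles of the graph with edge codes `w`, and for any two edges one of
these cycles contains the first edge but not the second. -/
structure SeparatingCycles {n : ℕ} (w : Fin n → ℕ) (Cs : List (List (Fin n))) : Prop where
  nodup : ∀ C ∈ Cs, C.Nodup
  xor_eq_zero : ∀ C ∈ Cs, (C.map w).foldr (· ^^^ ·) 0 = 0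
  exists_mem_notMem : ∀ p q, p ≠ q → ∃ C ∈ Cs, p ∈ C ∧ q ∉ C

theorem sum_map_bits (l : List ℕ) : (l.map bits).sum = bits (l.foldr (· ^^^ ·) 0) := by
  induction l with
  | nil => exact bits_zero.symm
  | cons a l ih => rw [List.map_cons, List.sum_cons, ih, List.foldr_cons, bits_xor]

theorem SeparatingCycles.exists_isCircuit {n : ℕ} {w : Fin n → ℕ} {Cs : List (List (Fin n))}
    (hCs : SeparatingCycles w Cs) (hc : IsRep M fun e => bits (c e)) {g : Fin n → α}
    (hg : Function.Injective g) (hgE : Set.range g = M.E) (hcg : ∀ j, c (g j) = w j)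
    {p q : Fin n} (hpq : p ≠ q) : ∃ D, M.IsCircuit D ∧ g p ∈ D ∧ g q ∉ D := by
  classical
  obtain ⟨C, hC, hp, hq⟩ := hCs.exists_mem_notMem p q hpq
  have hsum : ∑ e ∈ (C.map g).toFinset, bits (c e) = 0 := by
    rw [List.sum_toFinset _ ((hCs.nodup C hC).map hg), ← bits_zero, ← hCs.xor_eq_zero C hC,
      ← sum_map_bits, List.map_map, List.map_map]
    simp only [Function.comp_def, hcg]
  obtain ⟨D, hD, hDc, hpD⟩ := hc.exists_isCircuit (by
    intro e he
    obtain ⟨j, -, rfl⟩ := List.mem_map.1 (List.mem_toFinset.1 he)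
    exact hgE ▸ Set.mem_range_self j) hsum (p := g p) (by simpa using ⟨p, hp, rfl⟩)
  refine ⟨D, hDc, hpD, fun h => hq ?_⟩
  have := hD h
  simpa [hg.eq_iff] using this

/-- A circuit through `p` that avoids `q` shows that `p` is not a coloop and, since a circuit and a
cocircuit never meet in one element, that `{p, q}` is not a cocircuit. -/
theorem IsRep.isMinimal_of_separatingCycles {β : Type*} {F : Matroid β}
    (hc : IsRep M fun e => bits (c e)) {n : ℕ} {g : Fin n → α} (hg : Function.Injective g)
    (hgE : Set.range g = M.E) {w : Fin n → ℕ} (hcg : ∀ j, c (g j) = w j)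
    {Cs : List (List (Fin n))} (hCs : SeparatingCycles w Cs) {i j : Fin n} (hi : w i ≠ 0)
    (hj : w j ≠ 0) (hij : w i ≠ w j)
    (h : ∃ M' : Matroid (α ⊕ Unit), IsElementSplitting M {g i, g j} M' ∧
      (Isomorphic (M' ＼ {Sum.inr ()} ／ {Sum.inl (g i)}) F ∨
        Isomorphic (M' ＼ {Sum.inr ()} ／ {Sum.inl (g i), Sum.inl (g j)}) F ∨
        Isomorphic M' F ∨
        Isomorphic (M' ／ {Sum.inl (g i)}) F ∨
        Isomorphic (M' ／ {Sum.inl (g i), Sum.inl (g j)}) F)) : IsMinimal M F := by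
  have hmem : ∀ j, g j ∈ M.E := fun j => hgE ▸ Set.mem_range_self j
  have hne : i ≠ j := fun h => hij (h ▸ rfl)
  have hcl : ∀ p q : Fin n, p ≠ q → ¬ M.IsColoop (g p) := by
    intro p q hpq
    obtain ⟨D, hD, hp, -⟩ := hCs.exists_isCircuit hc hg hgE hcg hpq
    exact hD.not_isColoop_of_mem hp
  have h0 : ∀ {j}, w j ≠ 0 → bits (c (g j)) ≠ 0 := by
    intro j hj
    rwa [hcg, Ne, bits_eq_zero_iff]
  refine ⟨fun x y hxy hK => ?_, g i, hmem i, g j, hmem j, hg.ne hne, ?_, ?_, hcl i j hne,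
    hcl j i hne.symm, ?_, h⟩
  · have hE := hK.subset_ground
    obtain ⟨p, rfl⟩ := hgE.ge (hE (Set.mem_insert x {y}))
    obtain ⟨q, rfl⟩ := hgE.ge (hE (Set.mem_insert_of_mem _ rfl))
    obtain ⟨D, hD, hp, hq⟩ := hCs.exists_isCircuit hc hg hgE hcg fun h => hxy (congrArg g h)
    exact not_isCocircuit_pair_of_isCircuit hD hp hq hK
  · rw [hc.isLoop_iff (hmem i)]
    exact h0 hi
  · rw [hc.isLoop_iff (hmem j)]
    exact h0 hj
  · rw [hc.isCircuit_pair_iff (hmem i) (hmem j) (hg.ne hne) (h0 hi) (h0 hj), hcg, hcg,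
      bits_injective.eq_iff]
    exact hij

theorem range_comp_eq {n : ℕ} {g : Fin n → α} (hg : Function.Injective g)
    (hgE : Set.range g = M.E) {T : List (Fin n)} {k : ℕ} {ψ : Fin k → Fin n}
    (hψ : ∀ l, (∃ m, ψ m = l) ↔ l ∉ T) :
    Set.range (g ∘ ψ) = M.E \ g '' {l | l ∈ T} := by
  rw [Set.range_comp, ← hgE, ← Set.image_univ (f := g), ← Set.image_sdiff hg]
  congr 1
  ext l
  simpa using hψ l

theorem isK5Config_update {n : ℕ} {g : Fin n → α} (hg : Function.Injective g) {w : Fin n → ℕ}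
    (hcg : ∀ j, c (g j) = w j) {i j : Fin n} {ψ : Fin 10 → Fin n} [DecidableEq α]
    (hconf : CodeConfig [0] fun k => Function.update w j (w i ^^^ w j) (ψ k)) :
    IsK5Config fun k => Function.update (fun e => bits (c e)) (g j)
      (bits (c (g i)) + bits (c (g j))) ((g ∘ ψ) k) := by
  rw [← isK5Config_bits_iff] at hconf
  convert hconf using 2 with k
  by_cases hk : ψ k = j
  · simp [hk, bits_xor, hcg]
  · simp [hk, hcg, hg.eq_iff]

theorem isK5Config_quotLine {n : ℕ} {g : Fin n → α} {w : Fin n → ℕ}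
    (hcg : ∀ j, c (g j) = w j) {i j : Fin n} {ψ : Fin 10 → Fin n}
    (hconf : CodeConfig [0, w i ^^^ w j] fun k => w (ψ k)) :
    IsK5Config fun k => quotLine (bits (c (g i)) + bits (c (g j))) (bits (c ((g ∘ ψ) k))) := by
  rw [← isK5Config_quotLine_iff] at hconf
  rwa [← hcg i, ← hcg j, bits_xor,
    ← funext fun k => congrArg (quotLine _) (congrArg bits (hcg (ψ k)))] at hconf

theorem exists_codes_of_isomorphic {n m : ℕ} [NeZero n] {ends : Fin n → Sym2 (Fin m)}
    {d : Fin n → Fin m × Fin m} (hd : ∀ j, ends j = s((d j).1, (d j).2))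
    (h : Isomorphic M (cycleMatroid (graphOfEnds ends))) :
    ∃ (c : α → ℕ) (g : Fin n → α), (IsRep M fun e => bits (c e)) ∧ Function.Injective g ∧
      Set.range g = M.E ∧ (∀ j, c (g j) = edgeCode (d j)) ∧
      ∀ X, ∃ M', IsElementSplitting M X M' := by
  obtain ⟨r, hr, hrep⟩ := (isRep_graphOfEnds hd).exists_of_isomorphic h
  choose g hgE hg using fun j => hr.surjOn (show j ∈ (cycleMatroid (graphOfEnds ends)).E from
    Set.mem_univ j)
  refine ⟨fun e => edgeCode (d (r e)), g,
    hrep.congr (sameSums_bits_edgeCode fun e : M.E => d (r e)),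
    Function.LeftInverse.injective hg, ?_, fun j => congrArg (fun l => edgeCode (d l)) (hg j),
      fun X => ?_⟩
  · refine subset_antisymm (by rintro _ ⟨j, rfl⟩; exact hgE j) fun e he => ?_
    exact ⟨r e, hr.injOn (hgE _) he (hg _)⟩
  · refine exists_isElementSplitting
      (v := fun e => ⇑(edgeVec (d (r e)))) (hrep.congr (SameSums.of_injective
      (fun e : M.E => edgeVec (d (r e)))
      (Finsupp.linearEquivFunOnFinite (ZMod 2) (ZMod 2) (Fin m)).toLinearMap fun x _ hx => ?_)) X
    simpa using hx

theorem isMinimal_of_isomorphic_G11 (h : Isomorphic M (cycleMatroid G11)) :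
    IsMinimal M (cycleMatroid K5) := by
  classical
  obtain ⟨c, g, hc, hg, hgE, hcg, hM'⟩ := exists_codes_of_isomorphic (d := pairs₁₁) (by decide) h
  obtain ⟨M', hM'⟩ := hM' {g 0, g 2}
  -- `x` is one of the edges 01 and `y` one of the edges 02. Without `x`, and with `y` moved to the
  -- missing edge 12, `G11` is `K₅`; `ψ` lists its edges in the order of `k5Pair`.
  let ψ : Fin 10 → Fin 11 := ![1, 2, 3, 6, 4, 8, 7, 5, 9, 10]
  refine hc.isMinimal_of_separatingCycles hg hgE hcg (i := 0) (j := 2)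
    (Cs := [[0, 1, 2, 4, 8],
    [0, 3, 6, 9, 10], [4, 5, 6, 7], [1, 3, 7, 8, 10], [2, 5, 9], [3, 4, 8], [1, 4, 7, 10]])
    (by constructor <;> decide +kernel) (by decide) (by decide) (by decide) ⟨M', hM', ?_⟩
  have hne : bits (c (g 0)) ≠ bits (c (g 2)) := by
    rw [hcg, hcg, bits_injective.ne_iff]
    decide
  refine .inl <| (hM'.delete_contract_iff hc (hgE ▸ Set.mem_range_self _) hne).2
    ⟨g ∘ ψ, hg.comp (by decide), ?_, ?_⟩
  · simpa using range_comp_eq hg hgE (T := [0]) (ψ := ψ) (by decide)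
  · exact isK5Config_update hg hcg (by constructor <;> decide +kernel)

theorem isMinimal_of_isomorphic_G12 (h : Isomorphic M (cycleMatroid G12)) :
    IsMinimal M (cycleMatroid K5) := by
  classical
  obtain ⟨c, g, hc, hg, hgE, hcg, hM'⟩ := exists_codes_of_isomorphic (d := pairs₁₂) (by decide) h
  obtain ⟨M', hM'⟩ := hM' {g 7, g 10}
  -- `x = 24` and `y = 34`, so vertices 2 and 3 are identified: 24 and 25 serve as 34 and 35 in the
  -- `K₅` on 0, 1, 3, 4, 5.
  let ψ : Fin 10 → Fin 12 := ![0, 1, 4, 2, 5, 8, 3, 6, 9, 11]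
  refine hc.isMinimal_of_separatingCycles hg hgE hcg (i := 7) (j := 10)
    (Cs := [[0, 1, 4, 7, 8],
    [2, 3, 5, 6], [1, 3, 10, 11], [4, 6, 7, 9, 10], [0, 3, 5, 8, 9], [0, 2, 6, 11], [1, 2, 4, 5],
    [7, 8]])
    (by constructor <;> decide +kernel) (by decide) (by decide) (by decide) ⟨M', hM', ?_⟩
  have hne : bits (c (g 7)) ≠ bits (c (g 10)) := by
    rw [hcg, hcg, bits_injective.ne_iff]
    decide
  refine .inr <| .inl <| (hM'.delete_contract_pair_iff hc (hgE ▸ Set.mem_range_self _)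
    (hgE ▸ Set.mem_range_self _) hne).2
    ⟨g ∘ ψ, hg.comp (by decide), ?_, ?_⟩
  · simpa [Set.image_pair, Set.ofPred_or] using range_comp_eq hg hgE (T := [10, 7])
      (ψ := ψ) (by decide)
  · exact isK5Config_quotLine hcg (by constructor <;> decide +kernel)

theorem isMinimal_of_isomorphic_G13 (h : Isomorphic M (cycleMatroid G13)) :
    IsMinimal M (cycleMatroid K5) := by
  classical
  obtain ⟨c, g, hc, hg, hgE, hcg, hM'⟩ := exists_codes_of_isomorphic (d := pairs₁₃) (by decide) h
  obtain ⟨M', hM'⟩ := hM' {g 8, g 10}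
  -- `x = 25` and `y = 34`: modulo their sum, the other 25 serves as 34 and 24 as 35, in the `K₅` on
  -- 0, 1, 3, 4, 5.
  let ψ : Fin 10 → Fin 12 := ![0, 1, 4, 2, 5, 9, 3, 6, 7, 11]
  refine hc.isMinimal_of_separatingCycles hg hgE hcg (i := 8) (j := 10)
    (Cs := [[0, 1, 4, 8, 9],
    [2, 3, 5, 6], [1, 3, 10, 11], [4, 6, 7, 8, 10], [0, 3, 5, 7, 9], [0, 2, 6, 11], [1, 2, 4, 5],
    [8, 9]])
    (by constructor <;> decide +kernel) (by decide) (by decide) (by decide) ⟨M', hM', ?_⟩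
  have hne : bits (c (g 8)) ≠ bits (c (g 10)) := by
    rw [hcg, hcg, bits_injective.ne_iff]
    decide
  refine .inr <| .inl <| (hM'.delete_contract_pair_iff hc (hgE ▸ Set.mem_range_self _)
    (hgE ▸ Set.mem_range_self _) hne).2
    ⟨g ∘ ψ, hg.comp (by decide), ?_, ?_⟩
  · simpa [Set.image_pair, Set.ofPred_or] using range_comp_eq hg hgE (T := [10, 8])
      (ψ := ψ) (by decide)
  · exact isK5Config_quotLine hcg (by constructor <;> decide +kernel)

theorem isMinimal_of_isomorphic_G14 (h : Isomorphic M (cycleMatroid G14)) :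
    IsMinimal M (cycleMatroid K5) := by
  classical
  obtain ⟨c, g, hc, hg, hgE, hcg, hM'⟩ := exists_codes_of_isomorphic (d := pairs₁₄) (by decide) h
  obtain ⟨M', hM'⟩ := hM' {g 0, g 10}
  -- `x = 01` and `y = 45`: modulo their sum, 15, 05 and the other 45 serve as 04, 14 and 01, in the
  -- `K₅` on 0, 1, 2, 3, 4.
  let ψ : Fin 10 → Fin 12 := ![1, 2, 5, 9, 6, 7, 11, 3, 4, 8]
  refine hc.isMinimal_of_separatingCycles hg hgE hcg (i := 0) (j := 10)
    (Cs := [[0, 1, 3, 10, 11],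
    [2, 4, 8, 9], [5, 6, 7], [0, 2, 7, 9, 10], [1, 6, 8, 11], [3, 4, 5], [10, 11], [0, 1, 3], [0,
    2, 4], [0, 8, 9]])
    (by constructor <;> decide +kernel) (by decide) (by decide) (by decide) ⟨M', hM', ?_⟩
  have hne : bits (c (g 0)) ≠ bits (c (g 10)) := by
    rw [hcg, hcg, bits_injective.ne_iff]
    decide
  refine .inr <| .inl <| (hM'.delete_contract_pair_iff hc (hgE ▸ Set.mem_range_self _)
    (hgE ▸ Set.mem_range_self _) hne).2
    ⟨g ∘ ψ, hg.comp (by decide), ?_, ?_⟩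
  · simpa [Set.image_pair, Set.ofPred_or] using range_comp_eq hg hgE (T := [10, 0])
      (ψ := ψ) (by decide)
  · exact isK5Config_quotLine hcg (by constructor <;> decide +kernel)

theorem isMinimal_of_isomorphic_G15 (h : Isomorphic M (cycleMatroid G15)) :
    IsMinimal M (cycleMatroid K5) := by
  classical
  obtain ⟨c, g, hc, hg, hgE, hcg, hM'⟩ := exists_codes_of_isomorphic (d := pairs₁₅) (by decide) h
  obtain ⟨M', hM'⟩ := hM' {g 0, g 11}
  -- Again modulo 01 + 45: 15 and 05 serve as 04 and 14, and the second edge 01 is present already.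
  let ψ : Fin 10 → Fin 12 := ![1, 2, 4, 3, 5, 6, 10, 9, 7, 8]
  refine hc.isMinimal_of_separatingCycles hg hgE hcg (i := 0) (j := 11)
    (Cs := [[0, 1, 2, 3, 6],
    [4, 5, 7, 8], [2, 4, 9, 10], [0, 3, 8, 10, 11], [3, 6, 7, 9, 11], [1, 5, 8, 9, 11], [0, 2, 5,
    6]])
    (by constructor <;> decide +kernel) (by decide) (by decide) (by decide) ⟨M', hM', ?_⟩
  have hne : bits (c (g 0)) ≠ bits (c (g 11)) := by
    rw [hcg, hcg, bits_injective.ne_iff]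
    decide
  refine .inr <| .inl <| (hM'.delete_contract_pair_iff hc (hgE ▸ Set.mem_range_self _)
    (hgE ▸ Set.mem_range_self _) hne).2
    ⟨g ∘ ψ, hg.comp (by decide), ?_, ?_⟩
  · simpa [Set.image_pair, Set.ofPred_or] using range_comp_eq hg hgE (T := [11, 0])
      (ψ := ψ) (by decide)
  · exact isK5Config_quotLine hcg (by constructor <;> decide +kernel)

theorem isMinimal_of_isomorphic_G16 (h : Isomorphic M (cycleMatroid G16)) :
    IsMinimal M (cycleMatroid K5) := by
  classical
  obtain ⟨c, g, hc, hg, hgE, hcg, hM'⟩ := exists_codes_of_isomorphic (d := pairs₁₆) (by decide) h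
  obtain ⟨M', hM'⟩ := hM' {g 2, g 0}
  -- `x = 02` and `y` is one of the edges 01, moved to the missing edge 12; the new element stands
  -- in for `x`.
  let ψ : Fin 10 → Fin 10 := ![0, 1, 2, 5, 7, 3, 6, 8, 4, 9]
  refine hc.isMinimal_of_separatingCycles hg hgE hcg (i := 2) (j := 0)
    (Cs := [[0, 1, 2, 3, 7],
    [0, 4, 5, 9], [5, 6, 7, 8], [1, 3, 6, 9], [2, 4, 8], [0, 1], [0, 3, 5]])
    (by constructor <;> decide +kernel) (by decide) (by decide) (by decide) ⟨M', hM', ?_⟩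
  have hne : bits (c (g 2)) ≠ bits (c (g 0)) := by
    rw [hcg, hcg, bits_injective.ne_iff]
    decide
  refine .inr <| .inr <| .inr <| .inl <| (hM'.contract_iff hc (hgE ▸ Set.mem_range_self _) hne).2
    ⟨g ∘ ψ, hg.comp (by decide), ?_, ?_⟩
  · simpa using range_comp_eq hg hgE (T := []) (ψ := ψ) (by decide)
  · exact isK5Config_update hg hcg (by constructor <;> decide +kernel)

theorem isMinimal_of_isomorphic_G17 (h : Isomorphic M (cycleMatroid G17)) :
    IsMinimal M (cycleMatroid K5) := by
  classical
  obtain ⟨c, g, hc, hg, hgE, hcg, hM'⟩ := exists_codes_of_isomorphic (d := pairs₁₇) (by decide) h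
  obtain ⟨M', hM'⟩ := hM' {g 8, g 9}
  -- `x = 25` and `y = 01`: modulo their sum, 15, 05 and 25 serve as 02, 12 and 01, in the `K₅` on
  -- 0, 1, 2, 3, 4; the new element stands in for `x`.
  let ψ : Fin 10 → Fin 11 := ![0, 1, 10, 5, 6, 7, 8, 3, 4, 2]
  refine hc.isMinimal_of_separatingCycles hg hgE hcg (i := 8) (j := 9)
    (Cs := [[0, 2, 4, 5, 10],
    [1, 3, 6, 7, 9], [0, 5, 6, 8, 9], [1, 2, 7, 8], [3, 4, 10], [0, 1, 10], [3, 4, 6, 7], [2, 5,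
    9]])
    (by constructor <;> decide +kernel) (by decide) (by decide) (by decide) ⟨M', hM', ?_⟩
  have hne : bits (c (g 8)) ≠ bits (c (g 9)) := by
    rw [hcg, hcg, bits_injective.ne_iff]
    decide
  refine .inr <| .inr <| .inr <| .inr <| (hM'.contract_pair_iff hc (hgE ▸ Set.mem_range_self _)
    (hgE ▸ Set.mem_range_self _) hne).2
    ⟨g ∘ ψ, hg.comp (by decide), ?_, ?_⟩
  · simpa using range_comp_eq hg hgE (T := [9]) (ψ := ψ) (by decide)
  · exact isK5Config_quotLine hcg (by constructor <;> decide +kernel)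

end Backward
end ElementSplitting

theorem mainTheorem5 {α : Type*} (M : Matroid α) (hM : ElementSplitting.IsGraphic M) :
    ElementSplitting.IsMinimal M (ElementSplitting.cycleMatroid ElementSplitting.K5) ↔
      (ElementSplitting.Isomorphic M (ElementSplitting.cycleMatroid ElementSplitting.G11) ∨
        ElementSplitting.Isomorphic M (ElementSplitting.cycleMatroid ElementSplitting.G12) ∨
        ElementSplitting.Isomorphic M (ElementSplitting.cycleMatroid ElementSplitting.G13) ∨
        ElementSplitting.Isomorphic M (ElementSplitting.cycleMatroid ElementSplitting.G14) ∨
        ElementSplitting.Isomorphic M (ElementSplitting.cycleMatroid ElementSplitting.G15) ∨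
        ElementSplitting.Isomorphic M (ElementSplitting.cycleMatroid ElementSplitting.G16) ∨
        ElementSplitting.Isomorphic M (ElementSplitting.cycleMatroid ElementSplitting.G17)) := by
  constructor
  · exact fun h => h.isomorphic hM
  · rintro (h | h | h | h | h | h | h)
    · exact ElementSplitting.isMinimal_of_isomorphic_G11 h
    · exact ElementSplitting.isMinimal_of_isomorphic_G12 h
    · exact ElementSplitting.isMinimal_of_isomorphic_G13 h
    · exact ElementSplitting.isMinimal_of_isomorphic_G14 h
    · exact ElementSplitting.isMinimal_of_isomorphic_G15 h
    · exact ElementSplitting.isMinimal_of_isomorphic_G16 h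
    · exact ElementSplitting.isMinimal_of_isomorphic_G17 h
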